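/- Consider the plasma equilibrium system for the magnetic field $\mathbf B=(A,B,C)$ and the pressure $P$ as functions of $\mathbf x=(x,y,z)\in\mathbb R^3$, $$\operatorname{curl}\mathbf B\times\mathbf B-\operatorname{grad}P=0,\qquad \operatorname{div}\mathbf B=0,$$ written $\mathbf E(\mathbf u,\mathbf u_1)=0$ with $\mathbf u=(u^1,\dots,u^4)=(A,B,C,P)$ and $\mathbf u_1=(u^k_i)$, $u^k_i=\partial u^k/\partial x^i$. Here $(\mathbf x,\mathbf u,\mathbf u_1)$ are regarded as independent coordinates on $\mathbb R^{3+4+12}$. Let $D\subseteq\mathbb R^{3+4+12}$ be an open set (for instance the whole space) such that $D\cap\{\mathbf E=0\}$ is connected or empty. Consider an infinitesimal operator $$X=\sum_i\xi^i(\mathbf x,\mathbf u,\mathbf u_1)\frac{\partial}{\partial x^i}+\sum_k\eta^k(\mathbf x,\mathbf u,\mathbf u_1)\frac{\partial}{\partial u^k}$$ with coefficients smooth on $D$, and its prolongation $X_1=X+\sum_{i,k}\xi^k_i\,\partial/\partial u^k_i$, where $$\xi^k_i=D_i\eta^k-\sum_m u^k_mD_i\xi^m,\qquad D_i=\frac{\partial}{\partial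 x^i}+\sum_k u^k_i\frac{\partial}{\partial u^k}+\sum_{k,j}u^k_{ij}\frac{\partial}{\partial u^k_j}.$$ The operator $X$ is called admitted on $D$ if the determining equations $X_1\mathbf E=0$ hold at every point of $D$ with $\mathbf E=0$, identically in the second derivatives $u^k_{ij}=u^k_{ji}$ (no relation other than this symmetry is imposed on the second derivatives). (a) For all real constants $l_1,l_2,l_3,\beta,R,\alpha,\delta,\gamma,\mu$ the operator $$\begin{aligned}X={}&l_1\partial_x+l_2\partial_y+l_3\partial_z+\beta\,\partial_P+R\,(x\partial_x+y\partial_y+z\partial_z)+\alpha\,(A\partial_A+B\partial_B+C\partial_C+2P\partial_P)\\&+\delta\,(y\partial_x-x\partial_y+B\partial_A-A\partial_B)+\gamma\,(z\partial_x-x\partial_z+C\partial_A-A\partial_C)+\mu\,(z\partial_y-y\partial_z+C\partial_B-B\partial_C)\end{aligned}\qquad(*)$$ is admitted on the whole space. (b) Conversely, if $X$ is admitted on $D$, then there are real constants such that the coefficients of $X$ coincide with those of $(*)$ at every point of $D$ with $\mathbf E=0$; in particular, on the equations they do not depend on $\mathbf u_1$. (c) Consequently the system has no Lie transformations that depend on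 derivatives: let $X$ be admitted on $D$, let $r\in\mathbb R$, and let $a\mapsto(\mathbf f,\mathbf g,\mathbf h)(a)$ and $a\mapsto(\tilde{\mathbf f},\tilde{\mathbf g},\tilde{\mathbf h})(a)$, $|a|<r$, be two curves in $D\cap\{\mathbf E=0\}$, with $\mathbf f,\mathbf g,\mathbf h$ the transformed values of $\mathbf x,\mathbf u,\mathbf u_1$, each satisfying $\frac{d\mathbf f}{da}=\xi(\mathbf f,\mathbf g,\mathbf h)$ and $\frac{d\mathbf g}{da}=\eta(\mathbf f,\mathbf g,\mathbf h)$ (and likewise with tildes). If $(\mathbf f,\mathbf g)(0)=(\tilde{\mathbf f},\tilde{\mathbf g})(0)$, then $(\mathbf f,\mathbf g)(a)=(\tilde{\mathbf f},\tilde{\mathbf g})(a)$ for all $|a|<r$, whatever the initial derivatives $\mathbf h(0),\tilde{\mathbf h}(0)$. -/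

import Mathlib

open scoped Matrix ContDiff

namespace PlasmaEquilibrium

/-- The space of 1-jets `(𝐱, 𝐮, 𝐮₁)`: the point `𝐱 = (x, y, z)`, the values
`𝐮 = (A, B, C, P)` of the magnetic field `(A, B, C)` and of the pressure `P`, and all
first derivatives `𝐮₁`, where `J.2.2 k i` stands for `∂u^k/∂x^i`. -/
abbrev Jet1 : Type := (Fin 3 → ℝ) × (Fin 4 → ℝ) × (Fin 4 → Fin 3 → ℝ)

/-- The magnetic field `(A, B, C)` at a 1-jet. -/
def magneticField (J : Jet1) : Fin 3 → ℝ := fun i => J.2.1 i.castSucc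

/-- `curl 𝐁` at a 1-jet. -/
def curlField (J : Jet1) : Fin 3 → ℝ :=
  ![J.2.2 2 1 - J.2.2 1 2, J.2.2 0 2 - J.2.2 2 0, J.2.2 1 0 - J.2.2 0 1]

/-- `div 𝐁` at a 1-jet. -/
def divField (J : Jet1) : ℝ := ∑ i : Fin 3, J.2.2 i.castSucc i

/-- `grad P` at a 1-jet. -/
def gradPressure (J : Jet1) : Fin 3 → ℝ := J.2.2 3

/-- The left-hand sides `E₁, …, E₄` of the plasma equilibrium system:
the three components of `curl 𝐁 × 𝐁 - grad P`, followed by `div 𝐁`. -/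
def plasmaE (J : Jet1) : Fin 4 → ℝ :=
  let F := crossProduct (curlField J) (magneticField J) - gradPressure J
  ![F 0, F 1, F 2, divField J]

/-- The set `𝐄 = 0` in the space of 1-jets. -/
def equationSet : Set Jet1 := {J | plasmaE J = 0}

/-- Second derivatives: `S k i j` stands for `∂²u^k/∂x^i∂x^j`. -/
abbrev Second : Type := Fin 4 → Fin 3 → Fin 3 → ℝ

/-- Partial derivative in `x^i` of a function on the space of 1-jets. -/
noncomputable def partialX (i : Fin 3) (f : Jet1 → ℝ) (J : Jet1) : ℝ :=
  fderiv ℝ f J (Pi.single i 1, 0, 0)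

/-- Partial derivative in `u^k`. -/
noncomputable def partialU (k : Fin 4) (f : Jet1 → ℝ) (J : Jet1) : ℝ :=
  fderiv ℝ f J (0, Pi.single k 1, 0)

/-- Partial derivative in `u^k_i = ∂u^k/∂x^i`. -/
noncomputable def partialU1 (k : Fin 4) (i : Fin 3) (f : Jet1 → ℝ) (J : Jet1) : ℝ :=
  fderiv ℝ f J (0, 0, Pi.single k (Pi.single i 1))

/-- The operator of complete differentiation
`D_i f = ∂f/∂x^i + u^k_i ∂f/∂u^k + u^k_{ij} ∂f/∂u^k_j` for `f = f(𝐱, 𝐮, 𝐮₁)`, at the 2-jet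
formed by the 1-jet `J` and the second derivatives `S`. -/
noncomputable def totalDeriv (i : Fin 3) (f : Jet1 → ℝ) (J : Jet1) (S : Second) : ℝ :=
  partialX i f J + ∑ k, J.2.2 k i * partialU k f J
    + ∑ k, ∑ j, S k i j * partialU1 k j f J

/-- An infinitesimal operator `X = ∑ ξ^i ∂/∂x^i + ∑ η^k ∂/∂u^k` whose coordinates depend on
`(𝐱, 𝐮, 𝐮₁)`. -/
structure Generator where
  ξ : Jet1 → Fin 3 → ℝ
  η : Jet1 → Fin 4 → ℝ

/-- The coordinates of `X` are smooth on `D`. -/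
def Generator.SmoothOn (X : Generator) (D : Set Jet1) : Prop :=
  ContDiffOn ℝ ∞ X.ξ D ∧ ContDiffOn ℝ ∞ X.η D

/-- The coordinate `ξ^k_i = D_i η^k - ∑ₘ u^k_m D_i ξ^m` of the prolonged vector field. -/
noncomputable def Generator.prolongation (X : Generator) (k : Fin 4) (i : Fin 3)
    (J : Jet1) (S : Second) : ℝ :=
  totalDeriv i (fun J' => X.η J' k) J S
    - ∑ m, J.2.2 k m * totalDeriv i (fun J' => X.ξ J' m) J S

/-- The prolonged operator `X₁ = X + ∑ ξ^k_i ∂/∂u^k_i` applied to a function of 1-jets. -/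
noncomputable def Generator.prolongedApply (X : Generator) (F : Jet1 → ℝ)
    (J : Jet1) (S : Second) : ℝ :=
  ∑ i, X.ξ J i * partialX i F J + ∑ k, X.η J k * partialU k F J
    + ∑ k, ∑ i, X.prolongation k i J S * partialU1 k i F J

/-- The determining equations `X₁ 𝐄 = 0` under the restriction `𝐄 = 0`, on the domain `D` of the
generator. They hold identically in the second derivatives, on which only the symmetry of mixed
derivatives is imposed. -/
def Generator.IsAdmittedOn (X : Generator) (D : Set Jet1) : Prop :=
  ∀ J ∈ D ∩ equationSet, ∀ S : Second, (∀ k i j, S k i j = S k j i) →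
    ∀ a : Fin 4, X.prolongedApply (fun J' => plasmaE J' a) J S = 0

/-- The operator
`l₁ ∂x + l₂ ∂y + l₃ ∂z + β ∂P + R (x ∂x + y ∂y + z ∂z) + α (A ∂A + B ∂B + C ∂C + 2P ∂P)`
`+ δ (y ∂x - x ∂y + B ∂A - A ∂B) + γ (z ∂x - x ∂z + C ∂A - A ∂C) + μ (z ∂y - y ∂z + C ∂B - B ∂C)`. -/
def plasmaOperator (l₁ l₂ l₃ β R α δ γ μ : ℝ) : Generator where
  ξ J :=
    ![l₁ + R * J.1 0 + δ * J.1 1 + γ * J.1 2,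
      l₂ + R * J.1 1 - δ * J.1 0 + μ * J.1 2,
      l₃ + R * J.1 2 - γ * J.1 0 - μ * J.1 1]
  η J :=
    ![α * J.2.1 0 + δ * J.2.1 1 + γ * J.2.1 2,
      α * J.2.1 1 - δ * J.2.1 0 + μ * J.2.1 2,
      α * J.2.1 2 - γ * J.2.1 0 - μ * J.2.1 1,
      β + 2 * α * J.2.1 3]

/-- `c` is an orbit, for `|a| < r`, of the transformation generated by `X`: writing
`c a = (f, g, h)` for the transformed 1-jet, `∂f/∂a = ξ(f, g, h)` and `∂g/∂a = η(f, g, h)`, and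
the transformed 1-jet still satisfies the system. -/
def Generator.IsOrbit (X : Generator) (D : Set Jet1) (r : ℝ) (c : ℝ → Jet1) : Prop :=
  ∀ a : ℝ, |a| < r → c a ∈ D ∩ equationSet ∧
    HasDerivAt (fun s => (c s).1) (X.ξ (c a)) a ∧
    HasDerivAt (fun s => (c s).2.1) (X.η (c a)) a

end PlasmaEquilibrium

/-! Let `Generator.form` denote θ^k = dη^k - ∑ₘ u^k_m dξ^m. The determining equations are affine in
the second derivatives, with coefficients built from the values of θ^k on directions tangent to the
fibre of derivatives. Second derivatives of the form κ ⊗ κ reduce them to the principal symbol of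
the system, which is injective when κ · B ≠ 0 (`symbol_injective`). Such κ span all covectors if B ≠
0, and points with B = 0 are reached by continuity within the equations. Hence θ^k vanishes on the
fibre directions (`form_vertical`).

For fixed (x, u) this reads dη^k = ∑ₘ u^k_m dξ^m along the equations. Exterior differentiation gives
∑ₘ du^k_m ∧ dξ^m = 0, and two values of k with freely varying u^k_m already force dξ = 0, then dη =
0 (`contact_stationary`). So X is locally a point operator (`exists_point`); this is why no
dependence on derivatives survives.

The determining equations of a point operator are polynomial in the free first derivatives. Where B
≠ 0 their coefficients give `PointRelations`: ξ depends on x alone and is a conformal Killing field,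
and the derivatives of η are tied to those of ξ. Differentiating once in B gives η = (∂ξ/∂x) B + λ B
for the field components. Differentiating again, with ρ = ∂ξ^0/∂x^0, the divergence equation yields
grad λ = -3 grad ρ and the momentum equations yield B_j ∂_i ρ = 0, which excludes the special
conformal fields. All second derivatives vanish, so ξ and η are affine with nine free constants
(`exists_standard_of_isPointSymmetryAt`).

The constants are determined near each point, hence are constant on the connected set of equations.
The (x, u)-part of an orbit then solves an autonomous affine ODE in which the derivatives do not
occur, and ODE uniqueness gives (c). -/

namespace PlasmaEquilibrium

/-! ### Linearization of the system and admissibility of the nine-parameter operator -/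

/-- The differential of `plasmaE` in the direction `(·, η, ζ)` at a 1-jet `(·, u, p)`. -/
def linearizedE (u : Fin 4 → ℝ) (p : Fin 4 → Fin 3 → ℝ) (η : Fin 4 → ℝ)
    (ζ : Fin 4 → Fin 3 → ℝ) : Fin 4 → ℝ :=
  ![(ζ 0 2 - ζ 2 0) * u 2 - (ζ 1 0 - ζ 0 1) * u 1 + ((p 0 2 - p 2 0) * η 2 - (p 1 0 - p 0 1) * η 1)
      - ζ 3 0,
    (ζ 1 0 - ζ 0 1) * u 0 - (ζ 2 1 - ζ 1 2) * u 2 + ((p 1 0 - p 0 1) * η 0 - (p 2 1 - p 1 2) * η 2)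
      - ζ 3 1,
    (ζ 2 1 - ζ 1 2) * u 1 - (ζ 0 2 - ζ 2 0) * u 0 + ((p 2 1 - p 1 2) * η 1 - (p 0 2 - p 2 0) * η 0)
      - ζ 3 2,
    ζ 0 0 + ζ 1 1 + ζ 2 2]

theorem plasmaE_eq (J : Jet1) : plasmaE J =
    ![(J.2.2 0 2 - J.2.2 2 0) * J.2.1 2 - (J.2.2 1 0 - J.2.2 0 1) * J.2.1 1 - J.2.2 3 0,
      (J.2.2 1 0 - J.2.2 0 1) * J.2.1 0 - (J.2.2 2 1 - J.2.2 1 2) * J.2.1 2 - J.2.2 3 1,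
      (J.2.2 2 1 - J.2.2 1 2) * J.2.1 1 - (J.2.2 0 2 - J.2.2 2 0) * J.2.1 0 - J.2.2 3 2,
      J.2.2 0 0 + J.2.2 1 1 + J.2.2 2 2] := by
  simp [plasmaE, cross_apply, curlField, magneticField, gradPressure, divField, Fin.sum_univ_three]

theorem contDiff_plasmaE (a : Fin 4) : ContDiff ℝ ∞ (fun J => plasmaE J a) := by
  simp only [plasmaE_eq]
  fin_cases a <;> simp <;> fun_prop

theorem fderiv_plasmaE (J v : Jet1) (a : Fin 4) :
    fderiv ℝ (fun J' => plasmaE J' a) J v = linearizedE J.2.1 J.2.2 v.2.1 v.2.2 a := by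
  have hd : DifferentiableAt ℝ (fun J' => plasmaE J' a) J :=
    (contDiff_plasmaE a).differentiable (by simp) J
  rw [← hd.lineDeriv_eq_fderiv, lineDeriv]
  -- `plasmaE` is a quadratic form plus a linear one; the added vector cancels the linear part of
  -- `plasmaE v`, leaving the coefficient of t².
  have key : (fun t : ℝ => plasmaE (J + t • v) a) = fun t => plasmaE J a
      + t * linearizedE J.2.1 J.2.2 v.2.1 v.2.2 a
      + t ^ 2 * (plasmaE v a + ![v.2.2 3 0, v.2.2 3 1, v.2.2 3 2, -(v.2.2 0 0 + v.2.2 1 1 + v.2.2 2 2)] a) := by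
    funext t
    simp only [plasmaE_eq, linearizedE]
    fin_cases a <;> simp <;> ring
  rw [key]
  have h := ((hasDerivAt_const (0 : ℝ) (plasmaE J a)).add
    ((hasDerivAt_id (0 : ℝ)).mul_const (linearizedE J.2.1 J.2.2 v.2.1 v.2.2 a))).add
    (((hasDerivAt_id (0 : ℝ)).pow 2).mul_const
      (plasmaE v a + ![v.2.2 3 0, v.2.2 3 1, v.2.2 3 2, -(v.2.2 0 0 + v.2.2 1 1 + v.2.2 2 2)] a))
  refine (h.congr_deriv ?_).deriv
  simp

theorem clm_apply_jet (L : Jet1 →L[ℝ] ℝ) (a : Fin 3 → ℝ) (b : Fin 4 → ℝ) (c : Fin 4 → Fin 3 → ℝ) :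
    L (a, b, c) = ∑ i, a i * L (Pi.single i 1, 0, 0) + ∑ k, b k * L (0, Pi.single k 1, 0)
      + ∑ k, ∑ i, c k i * L (0, 0, Pi.single k (Pi.single i 1)) := by
  have h : ((a, b, c) : Jet1) = ∑ i, a i • ((Pi.single i 1, 0, 0) : Jet1)
      + ∑ k, b k • ((0, Pi.single k 1, 0) : Jet1)
      + ∑ k, ∑ i, c k i • ((0, 0, Pi.single k (Pi.single i 1)) : Jet1) := by
    refine Prod.ext ?_ (Prod.ext ?_ ?_)
    · funext i
      fin_cases i <;> simp [Fin.sum_univ_succ]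
    · funext i
      fin_cases i <;> simp [Fin.sum_univ_succ]
    · funext k i
      fin_cases k <;> fin_cases i <;> simp [Fin.sum_univ_succ]
  rw [h]
  simp only [map_add, map_sum, map_smul, smul_eq_mul]

theorem totalDeriv_eq (i : Fin 3) (f : Jet1 → ℝ) (J : Jet1) (S : Second) :
    totalDeriv i f J S = fderiv ℝ f J (Pi.single i 1, fun k => J.2.2 k i, fun k => S k i) := by
  rw [clm_apply_jet, totalDeriv]
  congr 2
  fin_cases i <;> simp [partialX, Pi.single_apply]

theorem Generator.prolongedApply_plasmaE (X : Generator) (J : Jet1) (S : Second) (a : Fin 4) :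
    X.prolongedApply (fun J' => plasmaE J' a) J S =
      linearizedE J.2.1 J.2.2 (X.η J) (fun k i => X.prolongation k i J S) a := by
  rw [← fderiv_plasmaE J (X.ξ J, X.η J, fun k i => X.prolongation k i J S) a, clm_apply_jet]
  rfl

/-- The form `dη^k - ∑ₘ u^k_m dξ^m` at a 1-jet. -/
noncomputable def Generator.form (X : Generator) (k : Fin 4) (J : Jet1) : Jet1 →L[ℝ] ℝ :=
  fderiv ℝ (fun J' => X.η J' k) J - ∑ m, J.2.2 k m • fderiv ℝ (fun J' => X.ξ J' m) J

theorem Generator.prolongation_eq (X : Generator) (k : Fin 4) (i : Fin 3) (J : Jet1) (S : Second) :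
    X.prolongation k i J S =
      X.form k J (Pi.single i 1, fun k => J.2.2 k i, fun k => S k i) := by
  simp [Generator.prolongation, Generator.form, totalDeriv_eq]

theorem mem_equationSet_iff (J : Jet1) : J ∈ equationSet ↔
    J.2.2 3 0 = (J.2.2 0 2 - J.2.2 2 0) * J.2.1 2 - (J.2.2 1 0 - J.2.2 0 1) * J.2.1 1 ∧
    J.2.2 3 1 = (J.2.2 1 0 - J.2.2 0 1) * J.2.1 0 - (J.2.2 2 1 - J.2.2 1 2) * J.2.1 2 ∧
    J.2.2 3 2 = (J.2.2 2 1 - J.2.2 1 2) * J.2.1 1 - (J.2.2 0 2 - J.2.2 2 0) * J.2.1 0 ∧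
    J.2.2 2 2 = -(J.2.2 0 0 + J.2.2 1 1) := by
  change plasmaE J = 0 ↔ _
  rw [plasmaE_eq, funext_iff, Fin.forall_fin_succ, Fin.forall_fin_succ, Fin.forall_fin_succ,
    Fin.forall_fin_succ]
  simp
  constructor
  · rintro ⟨h0, h1, h2, h3⟩
    refine ⟨?_, ?_, ?_, ?_⟩ <;> linarith
  · rintro ⟨h0, h1, h2, h3⟩
    refine ⟨?_, ?_, ?_, ?_⟩ <;> linarith

theorem fderiv_of_sub_eq {E : Type*} [NormedAddCommGroup E] [NormedSpace ℝ E] {f : E → ℝ} {l : E → ℝ}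
    (hf : Differentiable ℝ f) (hl : ∀ x v (t : ℝ), f (x + t • v) = f x + t * l v) (x v : E) :
    fderiv ℝ f x v = l v := by
  rw [← (hf x).lineDeriv_eq_fderiv, lineDeriv]
  simp only [hl]
  simp

theorem fderiv_plasmaOperator_ξ (l₁ l₂ l₃ β R α δ γ μ : ℝ) (J v : Jet1) (m : Fin 3) :
    fderiv ℝ (fun J' => (plasmaOperator l₁ l₂ l₃ β R α δ γ μ).ξ J' m) J v =
      (plasmaOperator 0 0 0 0 R α δ γ μ).ξ v m := by
  refine fderiv_of_sub_eq (f := fun J' => (plasmaOperator l₁ l₂ l₃ β R α δ γ μ).ξ J' m)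
    (l := fun v => (plasmaOperator 0 0 0 0 R α δ γ μ).ξ v m) ?_ ?_ J v
  · simp only [plasmaOperator]
    fin_cases m <;> simp <;> fun_prop
  · intro x v t
    simp only [plasmaOperator]
    fin_cases m <;> simp <;> ring

theorem fderiv_plasmaOperator_η (l₁ l₂ l₃ β R α δ γ μ : ℝ) (J v : Jet1) (k : Fin 4) :
    fderiv ℝ (fun J' => (plasmaOperator l₁ l₂ l₃ β R α δ γ μ).η J' k) J v =
      (plasmaOperator 0 0 0 0 R α δ γ μ).η v k := by
  refine fderiv_of_sub_eq (f := fun J' => (plasmaOperator l₁ l₂ l₃ β R α δ γ μ).η J' k)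
    (l := fun v => (plasmaOperator 0 0 0 0 R α δ γ μ).η v k) ?_ ?_ J v
  · simp only [plasmaOperator]
    fin_cases k <;> simp <;> fun_prop
  · intro x v t
    simp only [plasmaOperator]
    fin_cases k <;> simp <;> ring

theorem plasmaOperator_isAdmittedOn (l₁ l₂ l₃ β R α δ γ μ : ℝ) :
    (plasmaOperator l₁ l₂ l₃ β R α δ γ μ).IsAdmittedOn Set.univ := by
  rintro J ⟨-, hJ⟩ S - a
  obtain ⟨h0, h1, h2, h3⟩ := (mem_equationSet_iff J).1 hJ
  rw [Generator.prolongedApply_plasmaE]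
  simp only [Generator.prolongation_eq, Generator.form, sub_apply,
    sum_apply, smul_apply, fderiv_plasmaOperator_ξ,
    fderiv_plasmaOperator_η]
  -- The coefficients depend on (x, u) only, so `S` has dropped out; eliminating grad P and ∂C/∂z by
  -- the equations leaves polynomial identities.
  fin_cases a <;> simp [plasmaOperator, linearizedE, Fin.sum_univ_three] <;>
    rw [h3] <;> try rw [h0, h1, h2]
  all_goals ring

end PlasmaEquilibrium

/-! ### Principal symbol: the forms dη^k - ∑ u^k_m dξ^m vanish on fibre directions -/

namespace PlasmaEquilibrium

open Filter Topology

theorem eq_zero_of_eventually_punctured {g : ℝ → ℝ} (hg : ContinuousAt g 0)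
    (h : ∀ᶠ t in 𝓝[≠] (0 : ℝ), g t = 0) : g 0 = 0 := by
  have h1 : Tendsto g (𝓝[≠] 0) (𝓝 (g 0)) := hg.tendsto.mono_left nhdsWithin_le_nhds
  have h2 : Tendsto g (𝓝[≠] 0) (𝓝 0) := tendsto_const_nhds.congr' (h.mono fun t ht => ht.symm)
  exact tendsto_nhds_unique h1 h2

/-- The first derivatives of the 1-jet in the set `𝐄 = 0` that has values `u` and free
derivatives `G`. -/
def slope (u : Fin 4 → ℝ) (G : Fin 3 → Fin 3 → ℝ) : Fin 4 → Fin 3 → ℝ :=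
  ![![G 0 0, G 0 1, G 0 2], ![G 1 0, G 1 1, G 1 2], ![G 2 0, G 2 1, -(G 0 0 + G 1 1)],
    ![(G 0 2 - G 2 0) * u 2 - (G 1 0 - G 0 1) * u 1,
      (G 1 0 - G 0 1) * u 0 - (G 2 1 - G 1 2) * u 2,
      (G 2 1 - G 1 2) * u 1 - (G 0 2 - G 2 0) * u 0]]

/-- The 1-jet in the set `𝐄 = 0` with free coordinates `y` and `G`. -/
def lift (w : ((Fin 3 → ℝ) × (Fin 4 → ℝ)) × (Fin 3 → Fin 3 → ℝ)) : Jet1 :=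
  (w.1.1, w.1.2, slope w.1.2 w.2)

/-- The free coordinates of a 1-jet. -/
def freeCoord (J : Jet1) : ((Fin 3 → ℝ) × (Fin 4 → ℝ)) × (Fin 3 → Fin 3 → ℝ) :=
  ((J.1, J.2.1), fun i => J.2.2 i.castSucc)

theorem lift_mem (w : ((Fin 3 → ℝ) × (Fin 4 → ℝ)) × (Fin 3 → Fin 3 → ℝ)) :
    lift w ∈ equationSet := by
  rw [mem_equationSet_iff]
  simp [lift, slope]

theorem lift_freeCoord {J : Jet1} (hJ : J ∈ equationSet) : lift (freeCoord J) = J := by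
  obtain ⟨h0, h1, h2, h3⟩ := (mem_equationSet_iff J).1 hJ
  refine Prod.ext rfl (Prod.ext rfl ?_)
  funext k i
  fin_cases k <;> fin_cases i <;> simp [lift, slope, freeCoord, h0, h1, h2, h3]

theorem contDiff_lift : ContDiff ℝ ∞ lift := by
  have h : ContDiff ℝ ∞ (fun w : ((Fin 3 → ℝ) × (Fin 4 → ℝ)) × (Fin 3 → Fin 3 → ℝ) =>
      slope w.1.2 w.2) := by
    refine contDiff_pi' fun k => contDiff_pi' fun i => ?_
    fin_cases k <;> fin_cases i <;> simp [slope] <;> fun_prop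
  unfold lift
  fun_prop

theorem continuous_freeCoord : Continuous freeCoord := by
  unfold freeCoord
  fun_prop

theorem Generator.SmoothOn.contDiffAt_ξ {X : Generator} {D : Set Jet1} (hX : X.SmoothOn D)
    (hD : IsOpen D) {J : Jet1} (hJ : J ∈ D) (m : Fin 3) :
    ContDiffAt ℝ ∞ (fun J' => X.ξ J' m) J :=
  contDiffAt_pi.1 (hX.1.contDiffAt (hD.mem_nhds hJ)) m

theorem Generator.SmoothOn.contDiffAt_η {X : Generator} {D : Set Jet1} (hX : X.SmoothOn D)
    (hD : IsOpen D) {J : Jet1} (hJ : J ∈ D) (k : Fin 4) :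
    ContDiffAt ℝ ∞ (fun J' => X.η J' k) J :=
  contDiffAt_pi.1 (hX.2.contDiffAt (hD.mem_nhds hJ)) k

theorem Generator.SmoothOn.continuousAt_form {X : Generator} {D : Set Jet1} (hX : X.SmoothOn D)
    (hD : IsOpen D) {J : Jet1} (hJ : J ∈ D) (k : Fin 4) : ContinuousAt (X.form k) J := by
  have h1 := ((hX.contDiffAt_η hD hJ k).fderiv_right (m := 0) (by simp)).continuousAt
  have h2 := fun m => ((hX.contDiffAt_ξ hD hJ m).fderiv_right (m := 0) (by simp)).continuousAt
  unfold Generator.form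
  fun_prop

/-- The principal symbol of the system is injective on covectors not orthogonal to the field. -/
theorem symbol_injective {B κ : Fin 3 → ℝ} {q : Fin 4 → ℝ}
    (hs : κ 0 * B 0 + κ 1 * B 1 + κ 2 * B 2 ≠ 0)
    (h0 : (κ 2 * q 0 - κ 0 * q 2) * B 2 - (κ 0 * q 1 - κ 1 * q 0) * B 1 - κ 0 * q 3 = 0)
    (h1 : (κ 0 * q 1 - κ 1 * q 0) * B 0 - (κ 1 * q 2 - κ 2 * q 1) * B 2 - κ 1 * q 3 = 0)
    (h2 : (κ 1 * q 2 - κ 2 * q 1) * B 1 - (κ 2 * q 0 - κ 0 * q 2) * B 0 - κ 2 * q 3 = 0)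
    (h3 : κ 0 * q 0 + κ 1 * q 1 + κ 2 * q 2 = 0) : q = 0 := by
  -- Since (κ × q) × B = (κ · B) q - (q · B) κ, the momentum rows say (κ · B) q = (q · B + q₃) κ;
  -- pairing with κ and using κ · q = 0 isolates the scalar.
  have hm : (κ 0 ^ 2 + κ 1 ^ 2 + κ 2 ^ 2) * (q 0 * B 0 + q 1 * B 1 + q 2 * B 2 + q 3) = 0 := by
    linear_combination (-κ 0) * h0 - κ 1 * h1 - κ 2 * h2
      + (κ 0 * B 0 + κ 1 * B 1 + κ 2 * B 2) * h3
  have hκ : κ 0 ^ 2 + κ 1 ^ 2 + κ 2 ^ 2 ≠ 0 := by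
    intro h
    have e0 : κ 0 = 0 := by nlinarith [sq_nonneg (κ 0), sq_nonneg (κ 1), sq_nonneg (κ 2)]
    have e1 : κ 1 = 0 := by nlinarith [sq_nonneg (κ 0), sq_nonneg (κ 1), sq_nonneg (κ 2)]
    have e2 : κ 2 = 0 := by nlinarith [sq_nonneg (κ 0), sq_nonneg (κ 1), sq_nonneg (κ 2)]
    simp [e0, e1, e2] at hs
  have hm' := (mul_eq_zero.1 hm).resolve_left hκ
  have q0 : q 0 = 0 := (mul_eq_zero.1 (show q 0 * (κ 0 * B 0 + κ 1 * B 1 + κ 2 * B 2) = 0 by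
    linear_combination h0 + κ 0 * hm')).resolve_right hs
  have q1 : q 1 = 0 := (mul_eq_zero.1 (show q 1 * (κ 0 * B 0 + κ 1 * B 1 + κ 2 * B 2) = 0 by
    linear_combination h1 + κ 1 * hm')).resolve_right hs
  have q2 : q 2 = 0 := (mul_eq_zero.1 (show q 2 * (κ 0 * B 0 + κ 1 * B 1 + κ 2 * B 2) = 0 by
    linear_combination h2 + κ 2 * hm')).resolve_right hs
  have q3 : q 3 = 0 := by simpa [q0, q1, q2] using hm'
  funext k
  fin_cases k <;> assumption

/-- Subtracting the determining equations at `S = 0` from those where only u^l has second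
derivatives, equal to κ ⊗ κ, leaves the principal symbol at κ applied to the vector of the form
values over all k. -/
theorem Generator.IsAdmittedOn.form_single_eq_zero {X : Generator} {D : Set Jet1}
    (hX : X.IsAdmittedOn D) {J : Jet1} (hJ : J ∈ D ∩ equationSet) (l : Fin 4) {κ : Fin 3 → ℝ}
    (hκ : κ 0 * J.2.1 0 + κ 1 * J.2.1 1 + κ 2 * J.2.1 2 ≠ 0) (k : Fin 4) :
    X.form k J (0, 0, Pi.single l κ) = 0 := by
  have key : ∀ a, linearizedE J.2.1 J.2.2 0
      (fun k i => κ i * X.form k J (0, 0, Pi.single l κ)) a = 0 := by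
    intro a
    have h1 := hX J hJ (fun k i j => (Pi.single l κ : Fin 4 → Fin 3 → ℝ) k j * κ i) (by
      intro k i j
      by_cases hk : k = l
      · subst hk; simp [mul_comm]
      · simp [hk]) a
    have h2 := hX J hJ 0 (by intros; rfl) a
    rw [Generator.prolongedApply_plasmaE] at h1 h2
    have h3 : ∀ k i, X.prolongation k i J (fun k i j => (Pi.single l κ : Fin 4 → Fin 3 → ℝ) k j * κ i)
        = X.prolongation k i J 0 + κ i * X.form k J (0, 0, Pi.single l κ) := by
      intro k i
      rw [Generator.prolongation_eq, Generator.prolongation_eq, ← smul_eq_mul (κ i), ← map_smul,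
        ← map_add]
      congr 1
      refine Prod.ext (by simp) (Prod.ext (by simp) ?_)
      funext k j
      simp [mul_comm]
    simp only [h3] at h1
    simp only [linearizedE] at h1 h2 ⊢
    fin_cases a <;> simp at h1 h2 ⊢ <;> linarith
  have := symbol_injective (B := fun i => J.2.1 i.castSucc) (κ := κ)
    (q := fun k => X.form k J (0, 0, Pi.single l κ)) hκ
    (by simpa [linearizedE] using key 0) (by simpa [linearizedE] using key 1)
    (by simpa [linearizedE] using key 2) (by simpa [linearizedE] using key 3)
  exact congrFun this k

theorem Generator.IsAdmittedOn.form_vertical_of_ne {X : Generator} {D : Set Jet1}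
    (hX : X.IsAdmittedOn D) {J : Jet1} (hJ : J ∈ D ∩ equationSet)
    (hB : J.2.1 0 ^ 2 + J.2.1 1 ^ 2 + J.2.1 2 ^ 2 ≠ 0) (k : Fin 4) (v : Fin 4 → Fin 3 → ℝ) :
    X.form k J (0, 0, v) = 0 := by
  set B : Fin 3 → ℝ := fun i => J.2.1 i.castSucc with hBdef
  have h1 : ∀ (l : Fin 4) (κ : Fin 3 → ℝ), X.form k J (0, 0, Pi.single l κ) = 0 := by
    intro l κ
    -- A covector orthogonal to B is the difference of κ + B and B, both admissible because B · B ≠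
    -- 0.
    by_cases hκ : κ 0 * J.2.1 0 + κ 1 * J.2.1 1 + κ 2 * J.2.1 2 = 0
    · have hB' := hX.form_single_eq_zero hJ l (κ := B) (by
        intro h; apply hB; rw [← h]; simp [hBdef]; ring) k
      have hκB := hX.form_single_eq_zero hJ l (κ := κ + B) (by
        intro h; apply hB
        have : (κ + B) 0 * J.2.1 0 + (κ + B) 1 * J.2.1 1 + (κ + B) 2 * J.2.1 2
          = (κ 0 * J.2.1 0 + κ 1 * J.2.1 1 + κ 2 * J.2.1 2)
            + (J.2.1 0 ^ 2 + J.2.1 1 ^ 2 + J.2.1 2 ^ 2) := by simp [hBdef]; ring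
        rw [this, hκ] at h; linarith) k
      have : ((0, 0, Pi.single l (κ + B)) : Jet1) = (0, 0, Pi.single l κ) + (0, 0, Pi.single l B) := by
        simp [Pi.single_add]
      rw [this, map_add, hB'] at hκB
      simpa using hκB
    · exact hX.form_single_eq_zero hJ l hκ k
  have h2 : ((0, 0, v) : Jet1) = ∑ l, (0, 0, Pi.single l (v l)) := by
    refine Prod.ext (by simp [Prod.fst_sum]) (Prod.ext (by simp [Prod.fst_sum, Prod.snd_sum]) ?_)
    simp only [Prod.snd_sum]
    exact (Finset.univ_sum_single v).symm
  rw [h2, map_sum]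
  exact Finset.sum_eq_zero fun l _ => h1 l (v l)

theorem Generator.IsAdmittedOn.form_vertical {X : Generator} {D : Set Jet1}
    (hX : X.IsAdmittedOn D) (hD : IsOpen D) (hS : X.SmoothOn D)
    {J : Jet1} (hJ : J ∈ D ∩ equationSet) (k : Fin 4) (v : Fin 4 → Fin 3 → ℝ) :
    X.form k J (0, 0, v) = 0 := by
  by_cases hB : J.2.1 0 ^ 2 + J.2.1 1 ^ 2 + J.2.1 2 ^ 2 = 0
  swap
  · exact hX.form_vertical_of_ne hJ hB k v
  have hB0 : J.2.1 0 = 0 := by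
    nlinarith [sq_nonneg (J.2.1 0), sq_nonneg (J.2.1 1), sq_nonneg (J.2.1 2)]
  -- A path inside the equations through `J` that moves only A among the values; the field is
  -- non-zero on it for t ≠ 0.
  set p : ℝ → Jet1 := fun t => lift ((J.1, J.2.1 + t • Pi.single 0 1), (freeCoord J).2) with hp
  have hp0 : p 0 = J := by
    rw [hp]; simpa [freeCoord] using lift_freeCoord hJ.2
  have hpc : Continuous p := by
    have := contDiff_lift.continuous
    fun_prop
  have hg : ContinuousAt (fun t => X.form k (p t) (0, 0, v)) 0 := by
    have h1 := hS.continuousAt_form hD hJ.1 k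
    rw [← hp0] at h1
    have h2 : ContinuousAt (fun t => X.form k (p t)) 0 :=
      ContinuousAt.comp (f := p) h1 hpc.continuousAt
    exact h2.clm_apply continuousAt_const
  have := eq_zero_of_eventually_punctured hg (by
    have hmem : ∀ᶠ t in 𝓝 (0 : ℝ), p t ∈ D :=
      hpc.continuousAt.eventually (by rw [hp0]; exact hD.mem_nhds hJ.1)
    filter_upwards [hmem.filter_mono nhdsWithin_le_nhds, self_mem_nhdsWithin] with t ht ht0
    refine hX.form_vertical_of_ne ⟨ht, lift_mem _⟩ ?_ k v
    have e : (p t).2.1 0 = t := by simp [hp, lift, hB0]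
    have : 0 < (p t).2.1 0 ^ 2 := by
      rw [e]
      have ht' : t ≠ 0 := ht0
      positivity
    positivity)
  rwa [hp0] at this

end PlasmaEquilibrium

/-! ### Contact relations: an admitted operator is locally a point operator -/

namespace PlasmaEquilibrium

open Filter Topology

/-- This is d(dg) = 0, that is ∑ₘ ℓₘ ∧ dfₘ = 0: in the symmetry of the second derivative of g, the
terms with second derivatives of fₘ cancel. -/
theorem contact_symm {E : Type*} [NormedAddCommGroup E] [NormedSpace ℝ E] {f : Fin 3 → E → ℝ}
    {g : E → ℝ} {ℓ : Fin 3 → E →L[ℝ] ℝ} {w : E} (hf : ∀ m, ContDiffAt ℝ ∞ (f m) w)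
    (hg : ContDiffAt ℝ ∞ g w)
    (h : fderiv ℝ g =ᶠ[𝓝 w] fun w' => ∑ m, ℓ m w' • fderiv ℝ (f m) w') (H H' : E) :
    ∑ m, ℓ m H * fderiv ℝ (f m) w H' = ∑ m, ℓ m H' * fderiv ℝ (f m) w H := by
  have hm : minSmoothness ℝ 2 ≤ (∞ : WithTop ℕ∞) := by
    rw [minSmoothness_of_isRCLikeNormedField]; exact WithTop.coe_le_coe.2 le_top
  have hdf : ∀ m, DifferentiableAt ℝ (fderiv ℝ (f m)) w := fun m =>
    ((hf m).fderiv_right (m := 1) (by exact WithTop.coe_le_coe.2 le_top)).differentiableAt (by simp)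
  have hd : HasFDerivAt (fun w' => ∑ m, ℓ m w' • fderiv ℝ (f m) w')
      (∑ m, (ℓ m w • fderiv ℝ (fderiv ℝ (f m)) w + (ℓ m).smulRight (fderiv ℝ (f m) w))) w :=
    HasFDerivAt.fun_sum fun m _ => (ℓ m).hasFDerivAt.smul (hdf m).hasFDerivAt
  have hs := hg.isSymmSndFDerivAt hm H H'
  rw [h.fderiv_eq, hd.fderiv] at hs
  have hs' : ∀ m, fderiv ℝ (fderiv ℝ (f m)) w H H' = fderiv ℝ (fderiv ℝ (f m)) w H' H :=
    fun m => (hf m).isSymmSndFDerivAt hm H H'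
  simp only [sum_apply, add_apply, smul_apply, ContinuousLinearMap.smulRight_apply, smul_eq_mul, hs',
    Finset.sum_add_distrib] at hs
  linarith

/-- Functions with a contact relation `dg = ∑ₘ G_{im} df_m` for two rows `i` are stationary. -/
theorem contact_stationary {f : Fin 3 → (Fin 3 → Fin 3 → ℝ) → ℝ}
    {g₀ g₁ : (Fin 3 → Fin 3 → ℝ) → ℝ} {G : Fin 3 → Fin 3 → ℝ} (hf : ∀ m, ContDiffAt ℝ ∞ (f m) G)
    (hg₀ : ContDiffAt ℝ ∞ g₀ G) (hg₁ : ContDiffAt ℝ ∞ g₁ G)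
    (h₀ : ∀ᶠ G' in 𝓝 G, ∀ H, fderiv ℝ g₀ G' H = ∑ m, G' 0 m * fderiv ℝ (f m) G' H)
    (h₁ : ∀ᶠ G' in 𝓝 G, ∀ H, fderiv ℝ g₁ G' H = ∑ m, G' 1 m * fderiv ℝ (f m) G' H) (m : Fin 3) :
    fderiv ℝ (f m) G = 0 := by
  let ℓ : Fin 3 → Fin 3 → (Fin 3 → Fin 3 → ℝ) →L[ℝ] ℝ := fun i m =>
    (ContinuousLinearMap.proj (R := ℝ) (φ := fun _ : Fin 3 => ℝ) m).comp
      (ContinuousLinearMap.proj (R := ℝ) (φ := fun _ : Fin 3 => Fin 3 → ℝ) i)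
  have hℓ : ∀ i m G', ℓ i m G' = G' i m := fun i m G' => rfl
  have s₀ := contact_symm (ℓ := ℓ 0) hf hg₀ (h₀.mono fun G' h => by
    ext H; simp [h H, hℓ])
  have s₁ := contact_symm (ℓ := ℓ 1) hf hg₁ (h₁.mono fun G' h => by
    ext H; simp [h H, hℓ])
  ext H
  -- Row 0 shows that dfₘ kills every direction with zero row 0; row 1 shows that it kills those
  -- supported in row 0.
  have e₀ := s₀ (Pi.single 0 (Pi.single m 1)) (H - Pi.single 0 (H 0))
  have e₁ := s₁ (Pi.single 1 (Pi.single m 1)) (Pi.single 0 (H 0))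
  simp [hℓ, Pi.single_apply] at e₀ e₁
  rw [e₁, sub_zero] at e₀
  simpa using e₀

theorem contDiff_linearizedE {u : Fin 4 → ℝ} {η : Fin 4 → ℝ}
    {ζ : (Fin 3 → Fin 3 → ℝ) → Fin 4 → Fin 3 → ℝ} (hζ : ∀ k i, ContDiff ℝ ω fun G => ζ G k i)
    (a : Fin 4) :
    ContDiff ℝ ω fun G => linearizedE u (slope u G) η (ζ G) a := by
  fin_cases a <;> simp [linearizedE, slope] <;> fun_prop

theorem contDiff_slope {n : WithTop ℕ∞} (u : Fin 4 → ℝ) (k : Fin 4) (i : Fin 3) :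
    ContDiff ℝ n fun G => slope u G k i := by
  fin_cases k <;> fin_cases i <;> simp [slope] <;> fun_prop

theorem fderiv_comp_lift_right {F : Jet1 → ℝ} {y : (Fin 3 → ℝ) × (Fin 4 → ℝ)}
    {G : Fin 3 → Fin 3 → ℝ} (hF : DifferentiableAt ℝ F (lift (y, G))) (H : Fin 3 → Fin 3 → ℝ) :
    fderiv ℝ (fun G' => F (lift (y, G'))) G H =
      fderiv ℝ F (lift (y, G)) (0, 0, fderiv ℝ (slope y.2) G H) := by
  have hs : DifferentiableAt ℝ (slope y.2) G :=
    (contDiff_pi' fun k => contDiff_pi' fun i => contDiff_slope (n := 1) y.2 k i).differentiable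
      (by simp) G
  have hl : HasFDerivAt (fun G' => lift (y, G'))
      ((0 : (Fin 3 → Fin 3 → ℝ) →L[ℝ] (Fin 3 → ℝ)).prod
        ((0 : (Fin 3 → Fin 3 → ℝ) →L[ℝ] (Fin 4 → ℝ)).prod (fderiv ℝ (slope y.2) G))) G :=
    HasFDerivAt.prodMk (hasFDerivAt_const y.1 G)
      (HasFDerivAt.prodMk (hasFDerivAt_const y.2 G) hs.hasFDerivAt)
  have := HasFDerivAt.comp (f := fun G' => lift (y, G')) G hF.hasFDerivAt hl
  rw [HasFDerivAt.fderiv (f := fun G' => F (lift (y, G'))) this]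
  rfl

theorem fderiv_comp_lift_left {F : Jet1 → ℝ} {y : (Fin 3 → ℝ) × (Fin 4 → ℝ)}
    {G : Fin 3 → Fin 3 → ℝ} (hF : DifferentiableAt ℝ F (lift (y, G)))
    (v : (Fin 3 → ℝ) × (Fin 4 → ℝ)) :
    fderiv ℝ (fun y' => F (lift (y', G))) y v = fderiv ℝ F (lift (y, G))
      (v.1, v.2, fderiv ℝ (fun y' : (Fin 3 → ℝ) × (Fin 4 → ℝ) => slope y'.2 G) y v) := by
  have hs : DifferentiableAt ℝ (fun y' : (Fin 3 → ℝ) × (Fin 4 → ℝ) => slope y'.2 G) y := by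
    refine differentiableAt_pi.2 fun k => differentiableAt_pi.2 fun i => ?_
    fin_cases k <;> fin_cases i <;> simp [slope] <;> fun_prop
  have hl : HasFDerivAt (fun y' => lift (y', G))
      ((ContinuousLinearMap.fst ℝ (Fin 3 → ℝ) (Fin 4 → ℝ)).prod
        ((ContinuousLinearMap.snd ℝ (Fin 3 → ℝ) (Fin 4 → ℝ)).prod
        (fderiv ℝ (fun y' : (Fin 3 → ℝ) × (Fin 4 → ℝ) => slope y'.2 G) y))) y :=
    hasFDerivAt_fst.prodMk (hasFDerivAt_snd.prodMk hs.hasFDerivAt)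
  have := HasFDerivAt.comp (f := fun y' => lift (y', G)) y hF.hasFDerivAt hl
  rw [HasFDerivAt.fderiv (f := fun y' => F (lift (y', G))) this]
  rfl

section

variable {X : Generator} {D : Set Jet1} (hX : X.IsAdmittedOn D) (hD : IsOpen D) (hS : X.SmoothOn D)
  {y : (Fin 3 → ℝ) × (Fin 4 → ℝ)} {G : Fin 3 → Fin 3 → ℝ} (hJ : lift (y, G) ∈ D)

include hX hD hS hJ

theorem Generator.IsAdmittedOn.fderiv_vertical_η (k : Fin 4) (H : Fin 3 → Fin 3 → ℝ) :
    fderiv ℝ (fun G' => X.η (lift (y, G')) k) G H =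
      ∑ m, slope y.2 G k m * fderiv ℝ (fun G' => X.ξ (lift (y, G')) m) G H := by
  have h1 := hX.form_vertical hD hS ⟨hJ, lift_mem _⟩ k (fderiv ℝ (slope y.2) G H)
  rw [fderiv_comp_lift_right (F := fun J => X.η J k)
    ((hS.contDiffAt_η hD hJ k).differentiableAt (by simp))]
  have h2 := fun m => fderiv_comp_lift_right (F := fun J => X.ξ J m)
    ((hS.contDiffAt_ξ hD hJ m).differentiableAt (by simp)) H
  simp only [h2]
  simp only [Generator.form, sub_apply, sum_apply, smul_apply, smul_eq_mul] at h1
  exact sub_eq_zero.1 h1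

theorem Generator.IsAdmittedOn.fderiv_vertical_ξ_eq_zero (m : Fin 3) :
    fderiv ℝ (fun G' => X.ξ (lift (y, G')) m) G = 0 := by
  have hl : ContDiff ℝ ∞ fun G' => lift (y, G') := contDiff_lift.comp (contDiff_prodMk_right y)
  have hmem : ∀ᶠ G' in 𝓝 G, lift (y, G') ∈ D :=
    hl.continuous.continuousAt.eventually (hD.mem_nhds hJ)
  have hη : ∀ k, ContDiffAt ℝ ∞ (fun G' => X.η (lift (y, G')) k) G := fun k =>
    ContDiffAt.comp (f := fun G' => lift (y, G')) G (hS.contDiffAt_η hD hJ k) hl.contDiffAt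
  have hξ : ∀ m, ContDiffAt ℝ ∞ (fun G' => X.ξ (lift (y, G')) m) G := fun k =>
    ContDiffAt.comp (f := fun G' => lift (y, G')) G (hS.contDiffAt_ξ hD hJ k) hl.contDiffAt
  -- The rows of A and B in `slope` are entirely free, whereas those of C and P are tied by the
  -- equations.
  refine contact_stationary hξ (hη 0) (hη 1) ?_ ?_ m
  · filter_upwards [hmem] with G' hG' H
    rw [hX.fderiv_vertical_η hD hS hG']
    simp [slope, Fin.sum_univ_three]
  · filter_upwards [hmem] with G' hG' H
    rw [hX.fderiv_vertical_η hD hS hG']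
    simp [slope, Fin.sum_univ_three]

theorem Generator.IsAdmittedOn.fderiv_vertical_η_eq_zero (k : Fin 4) :
    fderiv ℝ (fun G' => X.η (lift (y, G')) k) G = 0 := by
  ext H
  rw [hX.fderiv_vertical_η hD hS hJ]
  simp [hX.fderiv_vertical_ξ_eq_zero hD hS hJ]

end

/-- The prolongation to first derivatives `p` of the point transformation field with coordinates
`ξ` and `η`. -/
noncomputable def pointProlongation (ξ : Fin 3 → (Fin 3 → ℝ) × (Fin 4 → ℝ) → ℝ)
    (η : Fin 4 → (Fin 3 → ℝ) × (Fin 4 → ℝ) → ℝ) (y : (Fin 3 → ℝ) × (Fin 4 → ℝ))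
    (p : Fin 4 → Fin 3 → ℝ) (k : Fin 4) (i : Fin 3) : ℝ :=
  fderiv ℝ (η k) y (Pi.single i 1, fun l => p l i)
    - ∑ m, p k m * fderiv ℝ (ξ m) y (Pi.single i 1, fun l => p l i)

/-- The determining equations for point transformations. -/
def IsPointSymmetryAt (ξ : Fin 3 → (Fin 3 → ℝ) × (Fin 4 → ℝ) → ℝ)
    (η : Fin 4 → (Fin 3 → ℝ) × (Fin 4 → ℝ) → ℝ) (y : (Fin 3 → ℝ) × (Fin 4 → ℝ)) : Prop :=
  ∀ (G : Fin 3 → Fin 3 → ℝ) (a : Fin 4), linearizedE y.2 (slope y.2 G) (fun k => η k y)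
    (pointProlongation ξ η y (slope y.2 G)) a = 0

/-- Near every point of the system, an admitted operator is a point operator. -/
theorem Generator.IsAdmittedOn.exists_point {X : Generator} {D : Set Jet1} (hX : X.IsAdmittedOn D)
    (hD : IsOpen D) (hS : X.SmoothOn D)
    {w₀ : ((Fin 3 → ℝ) × (Fin 4 → ℝ)) × (Fin 3 → Fin 3 → ℝ)} (hw₀ : lift w₀ ∈ D) :
    ∃ ε > 0, ∃ (ξ : Fin 3 → (Fin 3 → ℝ) × (Fin 4 → ℝ) → ℝ)
      (η : Fin 4 → (Fin 3 → ℝ) × (Fin 4 → ℝ) → ℝ),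
      (∀ m, ∀ y ∈ Metric.ball w₀.1 ε, ContDiffAt ℝ ∞ (ξ m) y) ∧
      (∀ k, ∀ y ∈ Metric.ball w₀.1 ε, ContDiffAt ℝ ∞ (η k) y) ∧
      (∀ w ∈ Metric.ball w₀ ε, ∀ m, X.ξ (lift w) m = ξ m w.1) ∧
      (∀ w ∈ Metric.ball w₀ ε, ∀ k, X.η (lift w) k = η k w.1) ∧
      ∀ y ∈ Metric.ball w₀.1 ε, IsPointSymmetryAt ξ η y := by
  obtain ⟨ε, hε, hball⟩ := Metric.isOpen_iff.1 (hD.preimage contDiff_lift.continuous) w₀ hw₀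
  obtain ⟨y₀, G₀⟩ := w₀
  rw [← ball_prod_same] at hball
  simp only [← ball_prod_same]
  have hmem : ∀ y ∈ Metric.ball y₀ ε, ∀ G ∈ Metric.ball G₀ ε, lift (y, G) ∈ D :=
    fun y hy G hG => hball ⟨hy, hG⟩
  have hG₀ : G₀ ∈ Metric.ball G₀ ε := Metric.mem_ball_self hε
  have hl : ∀ y, ContDiff ℝ ∞ fun G' => lift (y, G') := fun y =>
    contDiff_lift.comp (contDiff_prodMk_right y)
  have hl' : ∀ G, ContDiff ℝ ∞ fun y' => lift (y', G) := fun G =>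
    contDiff_lift.comp (contDiff_prodMk_left G)
  have cξ : ∀ m, ∀ y ∈ Metric.ball y₀ ε, ∀ G ∈ Metric.ball G₀ ε,
      X.ξ (lift (y, G)) m = X.ξ (lift (y, G₀)) m := fun m y hy G hG =>
    Metric.isOpen_ball.is_const_of_fderiv_eq_zero (𝕜 := ℝ) (f := fun G' => X.ξ (lift (y, G')) m)
      (convex_ball G₀ ε).isPreconnected
      (fun G' hG' => (DifferentiableAt.comp (f := fun G' => lift (y, G')) G'
        ((hS.contDiffAt_ξ hD (hmem y hy G' hG') m).differentiableAt (by simp))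
        ((hl y).differentiable (by simp) G')).differentiableWithinAt)
      (fun G' hG' => hX.fderiv_vertical_ξ_eq_zero hD hS (hmem y hy G' hG') m) hG hG₀
  have cη : ∀ k, ∀ y ∈ Metric.ball y₀ ε, ∀ G ∈ Metric.ball G₀ ε,
      X.η (lift (y, G)) k = X.η (lift (y, G₀)) k := fun k y hy G hG =>
    Metric.isOpen_ball.is_const_of_fderiv_eq_zero (𝕜 := ℝ) (f := fun G' => X.η (lift (y, G')) k)
      (convex_ball G₀ ε).isPreconnected
      (fun G' hG' => (DifferentiableAt.comp (f := fun G' => lift (y, G')) G'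
        ((hS.contDiffAt_η hD (hmem y hy G' hG') k).differentiableAt (by simp))
        ((hl y).differentiable (by simp) G')).differentiableWithinAt)
      (fun G' hG' => hX.fderiv_vertical_η_eq_zero hD hS (hmem y hy G' hG') k) hG hG₀
  refine ⟨ε, hε, fun m y => X.ξ (lift (y, G₀)) m, fun k y => X.η (lift (y, G₀)) k, ?_, ?_, ?_, ?_, ?_⟩
  · exact fun m y hy => ContDiffAt.comp (f := fun y' => lift (y', G₀)) y
      (hS.contDiffAt_ξ hD (hmem y hy G₀ hG₀) m) (hl' G₀).contDiffAt
  · exact fun k y hy => ContDiffAt.comp (f := fun y' => lift (y', G₀)) y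
      (hS.contDiffAt_η hD (hmem y hy G₀ hG₀) k) (hl' G₀).contDiffAt
  · exact fun w hw m => cξ m w.1 hw.1 w.2 hw.2
  · exact fun w hw k => cη k w.1 hw.1 w.2 hw.2
  · intro y hy G a
    have hcd : ContDiff ℝ ω fun G => linearizedE y.2 (slope y.2 G)
        (fun k => X.η (lift (y, G₀)) k) (pointProlongation (fun m y => X.ξ (lift (y, G₀)) m)
          (fun k y => X.η (lift (y, G₀)) k) y (slope y.2 G)) a := by
      refine contDiff_linearizedE (fun k i => ?_) a
      have hs := fun k i => contDiff_slope (n := ω) y.2 k i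
      have hv : ContDiff ℝ ω fun G => ((Pi.single i 1, fun l => slope y.2 G l i) :
          (Fin 3 → ℝ) × (Fin 4 → ℝ)) := by fun_prop
      unfold pointProlongation
      fun_prop
    -- Admissibility gives the identity only for G near `G₀`; analyticity in G extends it to all G,
    -- so that arbitrary test matrices may be inserted later.
    refine congrFun (AnalyticOnNhd.eq_of_eventuallyEq (g := fun _ => 0) hcd.analyticOnNhd
      analyticOnNhd_const (z₀ := G₀) ?_) G
    filter_upwards [Metric.ball_mem_nhds G₀ hε] with G hG
    have hJ := hmem y hy G hG
    have h0 := hX _ ⟨hJ, lift_mem _⟩ 0 (by intros; rfl) a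
    rw [Generator.prolongedApply_plasmaE] at h0
    have e1 : X.η (lift (y, G)) = fun k => X.η (lift (y, G₀)) k := funext fun k => cη k y hy G hG
    have e2 : (fun k i => X.prolongation k i (lift (y, G)) 0) = pointProlongation
        (fun m y => X.ξ (lift (y, G₀)) m) (fun k y => X.η (lift (y, G₀)) k) y (slope y.2 G) := by
      funext k i
      have d1 : ∀ v, fderiv ℝ (fun y' => X.η (lift (y', G₀)) k) y v
          = fderiv ℝ (fun y' => X.η (lift (y', G)) k) y v := by
        intro v
        congr 1
        refine Filter.EventuallyEq.fderiv_eq ?_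
        filter_upwards [Metric.isOpen_ball.mem_nhds hy] with y' hy'
        exact (cη k y' hy' G hG).symm
      have d2 : ∀ m v, fderiv ℝ (fun y' => X.ξ (lift (y', G₀)) m) y v
          = fderiv ℝ (fun y' => X.ξ (lift (y', G)) m) y v := by
        intro m v
        congr 1
        refine Filter.EventuallyEq.fderiv_eq ?_
        filter_upwards [Metric.isOpen_ball.mem_nhds hy] with y' hy'
        exact (cξ m y' hy' G hG).symm
      have l1 := fderiv_comp_lift_left (F := fun J => X.η J k)
        ((hS.contDiffAt_η hD hJ k).differentiableAt (by simp))
        (Pi.single i 1, fun l => slope y.2 G l i)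
      have l2 := fun m => fderiv_comp_lift_left (F := fun J => X.ξ J m)
        ((hS.contDiffAt_ξ hD hJ m).differentiableAt (by simp))
        (Pi.single i 1, fun l => slope y.2 G l i)
      simp only [pointProlongation, d1, d2, l1, l2]
      set V := fderiv ℝ (fun y' : (Fin 3 → ℝ) × (Fin 4 → ℝ) => slope y'.2 G) y
        (Pi.single i 1, fun l => slope y.2 G l i)
      rw [Generator.prolongation_eq]
      -- With G fixed, moving (x, u) inside the equations changes the dependent derivatives by `V`;
      -- this extra fibre term is killed by `form_vertical`.
      have split : ((Pi.single i 1, fun l => slope y.2 G l i, V) : Jet1)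
          = (Pi.single i 1, fun l => slope y.2 G l i, fun k => (0 : Second) k i) + (0, 0, V) := by
        refine Prod.ext (by simp) (Prod.ext (by simp) ?_)
        funext k j
        simp
      have hform : X.form k (lift (y, G)) (Pi.single i 1, fun l => slope y.2 G l i, V)
          = X.form k (lift (y, G))
            (Pi.single i 1, fun l => slope y.2 G l i, fun k => (0 : Second) k i) := by
        rw [split, map_add, hX.form_vertical hD hS ⟨hJ, lift_mem _⟩ k V, add_zero]
      refine hform.symm.trans ?_
      simp [Generator.form, lift]
    rw [e1, e2] at h0
    exact h0

end PlasmaEquilibrium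

/-! ### Coefficients of the determining equations of a point operator -/

namespace PlasmaEquilibrium

/-- The determining equations of a point operator in terms of the values `η` and of the first
derivatives `ηx, ηu, ξx, ξu` of its coordinates. -/
def determining (u η : Fin 4 → ℝ) (ηx : Fin 4 → Fin 3 → ℝ) (ηu : Fin 4 → Fin 4 → ℝ)
    (ξx : Fin 3 → Fin 3 → ℝ) (ξu : Fin 3 → Fin 4 → ℝ) (p : Fin 4 → Fin 3 → ℝ) : Fin 4 → ℝ :=
  linearizedE u p η fun k i => ηx k i + ∑ l, p l i * ηu k l
    - ∑ m, p k m * (ξx m i + ∑ l, p l i * ξu m l)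

theorem slope_neg (u : Fin 4 → ℝ) (G : Fin 3 → Fin 3 → ℝ) : slope u (-G) = -slope u G := by
  funext k i
  fin_cases k <;> fin_cases i <;> simp [slope] <;> ring

theorem slope_zero (u : Fin 4 → ℝ) : slope u 0 = 0 := by
  funext k i
  fin_cases k <;> fin_cases i <;> simp [slope]

section

variable {u η : Fin 4 → ℝ} {ηx : Fin 4 → Fin 3 → ℝ} {ηu : Fin 4 → Fin 4 → ℝ}
  {ξx : Fin 3 → Fin 3 → ℝ} {ξu : Fin 3 → Fin 4 → ℝ}

/-- `slope` is linear in G, so the values at G and -G minus twice the value at 0 isolate the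
quadratic part of the divergence equation. -/
theorem determining_quadratic (h : ∀ G a, determining u η ηx ηu ξx ξu (slope u G) a = 0)
    (G : Fin 3 → Fin 3 → ℝ) :
    ∑ i : Fin 3, ∑ m : Fin 3, ∑ l : Fin 4,
      slope u G i.castSucc m * slope u G l i * ξu m l = 0 := by
  have h0 := h 0 3
  have h1 := h G 3
  have h2 := h (-G) 3
  rw [slope_neg] at h2
  rw [slope_zero] at h0
  generalize slope u G = p at *
  simp [determining, linearizedE, Fin.sum_univ_succ] at *
  linarith

theorem determining_constant (h : ∀ G a, determining u η ηx ηu ξx ξu (slope u G) a = 0) :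
    (ηx 0 2 - ηx 2 0) * u 2 - (ηx 1 0 - ηx 0 1) * u 1 = ηx 3 0 ∧
    (ηx 1 0 - ηx 0 1) * u 0 - (ηx 2 1 - ηx 1 2) * u 2 = ηx 3 1 ∧
    (ηx 2 1 - ηx 1 2) * u 1 - (ηx 0 2 - ηx 2 0) * u 0 = ηx 3 2 ∧
    ηx 0 0 + ηx 1 1 + ηx 2 2 = 0 := by
  have h0 := h 0
  rw [slope_zero] at h0
  have e0 := h0 0
  have e1 := h0 1
  have e2 := h0 2
  have e3 := h0 3
  simp [determining, linearizedE] at e0 e1 e2 e3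
  refine ⟨?_, ?_, ?_, ?_⟩ <;> linarith

theorem determining_ξu (h : ∀ G a, determining u η ηx ηu ξx ξu (slope u G) a = 0)
    (hu : u 0 ≠ 0 ∨ u 1 ≠ 0 ∨ u 2 ≠ 0) : ξu = 0 := by
  have q := determining_quadratic h
  -- The entries lie in one row i off the diagonal, so only grad P contributes to column i. The
  -- results are u_m ξu_{m3} = 0 and (u_m + u_n)(ξu_{m3} + ξu_{n3}) = 0, enough once some u_m ≠ 0.
  have a0 := q ![![0,0,0],![1,0,0],![0,0,0]]
  have a1 := q ![![0,1,0],![0,0,0],![0,0,0]]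
  have a2 := q ![![0,0,1],![0,0,0],![0,0,0]]
  have b0 := q ![![0,0,0],![0,0,0],![1,1,0]]
  have b1 := q ![![0,1,1],![0,0,0],![0,0,0]]
  have b2 := q ![![0,0,0],![1,0,1],![0,0,0]]
  simp [slope, Fin.sum_univ_succ] at a0 a1 a2 b0 b1 b2
  have c0 : ξu 0 3 = 0 := by grind
  have c1 : ξu 1 3 = 0 := by grind
  have c2 : ξu 2 3 = 0 := by grind
  clear a0 a1 a2 b0 b1 b2
  -- Without the pressure column the quadratic relations no longer involve u; nine matrices settle
  -- the nine remaining entries.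
  have d0 := q ![![1,0,0],![0,-1,0],![0,0,0]]
  have d1 := q ![![1,0,0],![0,0,0],![0,0,0]]
  have d2 := q ![![0,0,0],![0,1,0],![0,0,0]]
  have f0 := q ![![0,1,0],![0,0,1],![0,0,0]]
  have f1 := q ![![0,0,1],![0,0,0],![0,1,0]]
  have f2 := q ![![0,0,1],![1,0,0],![0,0,0]]
  have f3 := q ![![0,0,0],![0,0,1],![1,0,0]]
  have f4 := q ![![0,0,0],![1,0,0],![0,1,0]]
  have f5 := q ![![0,1,0],![0,0,0],![1,0,0]]
  simp [slope, Fin.sum_univ_succ, c0, c1, c2] at d0 d1 d2 f0 f1 f2 f3 f4 f5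
  funext m l
  fin_cases m <;> fin_cases l <;> simp <;> linarith

/-- Once `ξu` vanishes the equations are affine in G, and the constant part vanishes separately. -/
theorem determining_linear (h : ∀ G a, determining u η ηx ηu ξx ξu (slope u G) a = 0)
    (hu : u 0 ≠ 0 ∨ u 1 ≠ 0 ∨ u 2 ≠ 0) (G : Fin 3 → Fin 3 → ℝ) (a : Fin 4) :
    determining u η 0 ηu ξx 0 (slope u G) a = 0 := by
  obtain ⟨c0, c1, c2, c3⟩ := determining_constant h
  have h1 := h G a
  rw [determining_ξu h hu] at h1
  fin_cases a <;> simp [determining, linearizedE] at h1 ⊢ <;> linarith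

/-- The algebraic consequences of the determining equations at a point with non-zero field. -/
structure PointRelations (u η : Fin 4 → ℝ) (ηx : Fin 4 → Fin 3 → ℝ) (ηu : Fin 4 → Fin 4 → ℝ)
    (ξx : Fin 3 → Fin 3 → ℝ) (ξu : Fin 3 → Fin 4 → ℝ) : Prop where
  ξu_eq : ξu = 0
  skew : ∀ i j, i ≠ j → ξx i j + ξx j i = 0
  diag : ∀ i, ξx i i = ξx 0 0
  ηu_off : ∀ i j, i ≠ j → ηu i.castSucc j.castSucc = ξx i j
  ηu_diag : ∀ i : Fin 3, ηu i.castSucc i.castSucc - ξx i i = ηu 0 0 - ξx 0 0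
  ηu_pressure : ∀ i j : Fin 3, ηu i.castSucc 3 * u j.castSucc = ηu j.castSucc 3 * u i.castSucc
  η_parallel : ∀ i j : Fin 3, (η i.castSucc - ∑ l, ξx i l * u l.castSucc) * u j.castSucc
    = (η j.castSucc - ∑ l, ξx j l * u l.castSucc) * u i.castSucc
  pressure_u : ∀ j : Fin 3, ηu 3 j.castSucc = 0
  pressure_pressure : ∀ j : Fin 3, (ηu 3 3 - (ηu 0 0 - ξx 0 0) - 2 * ξx 0 0) * u j.castSucc
    = (η j.castSucc - ∑ l, ξx j l * u l.castSucc)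
      - (u 0 ^ 2 + u 1 ^ 2 + u 2 ^ 2) * ηu j.castSucc 3
  curl0 : (ηx 0 2 - ηx 2 0) * u 2 - (ηx 1 0 - ηx 0 1) * u 1 = ηx 3 0
  curl1 : (ηx 1 0 - ηx 0 1) * u 0 - (ηx 2 1 - ηx 1 2) * u 2 = ηx 3 1
  curl2 : (ηx 2 1 - ηx 1 2) * u 1 - (ηx 0 2 - ηx 2 0) * u 0 = ηx 3 2
  div : ηx 0 0 + ηx 1 1 + ηx 2 2 = 0

/-- Coefficients of the eight free derivatives in the divergence equation; the terms in `ηu k 3`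
appear because grad P is expressed through curl B. -/
theorem determining_div (h : ∀ G a, determining u η ηx ηu ξx ξu (slope u G) a = 0)
    (hu : u 0 ≠ 0 ∨ u 1 ≠ 0 ∨ u 2 ≠ 0) :
    ηu 0 1 = ξx 0 1 + u 1 * ηu 0 3 - u 0 * ηu 1 3 ∧
    ηu 1 0 = ξx 1 0 - u 1 * ηu 0 3 + u 0 * ηu 1 3 ∧
    ηu 0 2 = ξx 0 2 + u 2 * ηu 0 3 - u 0 * ηu 2 3 ∧
    ηu 2 0 = ξx 2 0 - u 2 * ηu 0 3 + u 0 * ηu 2 3 ∧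
    ηu 1 2 = ξx 1 2 + u 2 * ηu 1 3 - u 1 * ηu 2 3 ∧
    ηu 2 1 = ξx 2 1 - u 2 * ηu 1 3 + u 1 * ηu 2 3 ∧
    ηu 1 1 = ηu 0 0 - ξx 0 0 + ξx 1 1 ∧
    ηu 2 2 = ηu 0 0 - ξx 0 0 + ξx 2 2 := by
  have q := fun G => determining_linear h hu G 3
  have e00 := q ![![1,0,0],![0,0,0],![0,0,0]]
  have e11 := q ![![0,0,0],![0,1,0],![0,0,0]]
  have e01 := q ![![0,1,0],![0,0,0],![0,0,0]]
  have e02 := q ![![0,0,1],![0,0,0],![0,0,0]]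
  have e10 := q ![![0,0,0],![1,0,0],![0,0,0]]
  have e12 := q ![![0,0,0],![0,0,1],![0,0,0]]
  have e20 := q ![![0,0,0],![0,0,0],![1,0,0]]
  have e21 := q ![![0,0,0],![0,0,0],![0,1,0]]
  simp [determining, linearizedE, slope, Fin.sum_univ_succ] at e00 e11 e01 e02 e10 e12 e20 e21
  refine ⟨?_, ?_, ?_, ?_, ?_, ?_, ?_, ?_⟩ <;> linarith

set_option maxHeartbeats 2000000 in
theorem determining_momentum (h : ∀ G a, determining u η ηx ηu ξx ξu (slope u G) a = 0)
    (hu : u 0 ≠ 0 ∨ u 1 ≠ 0 ∨ u 2 ≠ 0) :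
    ξx 0 1 = -ξx 1 0 ∧ ξx 0 2 = -ξx 2 0 ∧ ξx 1 2 = -ξx 2 1 ∧
    ξx 1 1 = ξx 0 0 ∧ ξx 2 2 = ξx 0 0 ∧
    ηu 0 3 * u 1 = ηu 1 3 * u 0 ∧ ηu 0 3 * u 2 = ηu 2 3 * u 0 ∧ ηu 1 3 * u 2 = ηu 2 3 * u 1 ∧
    (η 0 - (ξx 0 0 * u 0 + ξx 0 1 * u 1 + ξx 0 2 * u 2)) * u 1 =
      (η 1 - (ξx 1 0 * u 0 + ξx 1 1 * u 1 + ξx 1 2 * u 2)) * u 0 ∧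
    (η 0 - (ξx 0 0 * u 0 + ξx 0 1 * u 1 + ξx 0 2 * u 2)) * u 2 =
      (η 2 - (ξx 2 0 * u 0 + ξx 2 1 * u 1 + ξx 2 2 * u 2)) * u 0 ∧
    (η 1 - (ξx 1 0 * u 0 + ξx 1 1 * u 1 + ξx 1 2 * u 2)) * u 2 =
      (η 2 - (ξx 2 0 * u 0 + ξx 2 1 * u 1 + ξx 2 2 * u 2)) * u 1 ∧
    ηu 3 0 = 0 ∧ ηu 3 1 = 0 ∧ ηu 3 2 = 0 ∧
    (ηu 3 3 - (ηu 0 0 - ξx 0 0) - 2 * ξx 0 0) * u 0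
      = (η 0 - (ξx 0 0 * u 0 + ξx 0 1 * u 1 + ξx 0 2 * u 2))
        - (u 0 ^ 2 + u 1 ^ 2 + u 2 ^ 2) * ηu 0 3 ∧
    (ηu 3 3 - (ηu 0 0 - ξx 0 0) - 2 * ξx 0 0) * u 1
      = (η 1 - (ξx 1 0 * u 0 + ξx 1 1 * u 1 + ξx 1 2 * u 2))
        - (u 0 ^ 2 + u 1 ^ 2 + u 2 ^ 2) * ηu 1 3 ∧
    (ηu 3 3 - (ηu 0 0 - ξx 0 0) - 2 * ξx 0 0) * u 2
      = (η 2 - (ξx 2 0 * u 0 + ξx 2 1 * u 1 + ξx 2 2 * u 2))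
        - (u 0 ^ 2 + u 1 ^ 2 + u 2 ^ 2) * ηu 2 3 := by
  obtain ⟨H01, H10, H02, H20, H12, H21, H11, H22⟩ := determining_div h hu
  have q : ∀ G (a : Fin 3), determining u η 0 ηu ξx 0 (slope u G) a.castSucc = 0 :=
    fun G a => determining_linear h hu G a.castSucc
  have e00 := q ![![1,0,0],![0,0,0],![0,0,0]]
  have e11 := q ![![0,0,0],![0,1,0],![0,0,0]]
  have e01 := q ![![0,1,0],![0,0,0],![0,0,0]]
  have e02 := q ![![0,0,1],![0,0,0],![0,0,0]]
  have e10 := q ![![0,0,0],![1,0,0],![0,0,0]]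
  have e12 := q ![![0,0,0],![0,0,1],![0,0,0]]
  have e20 := q ![![0,0,0],![0,0,0],![1,0,0]]
  have e21 := q ![![0,0,0],![0,0,0],![0,1,0]]
  rw [Fin.forall_fin_succ, Fin.forall_fin_succ, Fin.forall_fin_succ]
    at e00 e11 e01 e02 e10 e12 e20 e21
  simp [determining, linearizedE, slope, Fin.sum_univ_succ] at e00 e11 e01 e02 e10 e12 e20 e21
  obtain ⟨e00a, e00b, e00c⟩ := e00
  obtain ⟨e11a, e11b, e11c⟩ := e11
  obtain ⟨e01a, e01b, e01c⟩ := e01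
  obtain ⟨e02a, e02b, e02c⟩ := e02
  obtain ⟨e10a, e10b, e10c⟩ := e10
  obtain ⟨e12a, e12b, e12c⟩ := e12
  obtain ⟨e20a, e20b, e20c⟩ := e20
  obtain ⟨e21a, e21b, e21c⟩ := e21
  obtain ⟨l, hl⟩ : ∃ l, ηu 0 0 = l + ξx 0 0 := ⟨ηu 0 0 - ξx 0 0, by ring⟩
  clear h q
  simp only [H01, H10, H02, H20, H12, H21, H11, H22, hl] at *
  have s01 : (η 0 - (ξx 0 0 * u 0 + ξx 0 1 * u 1 + ξx 0 2 * u 2)) * u 1 =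
      (η 1 - (ξx 1 0 * u 0 + ξx 1 1 * u 1 + ξx 1 2 * u 2)) * u 0 := by
    linear_combination u 1 * e20c - u 0 * e21c
  have s02 : (η 0 - (ξx 0 0 * u 0 + ξx 0 1 * u 1 + ξx 0 2 * u 2)) * u 2 =
      (η 2 - (ξx 2 0 * u 0 + ξx 2 1 * u 1 + ξx 2 2 * u 2)) * u 0 := by
    linear_combination u 2 * e10b - u 0 * e12b
  have s12 : (η 1 - (ξx 1 0 * u 0 + ξx 1 1 * u 1 + ξx 1 2 * u 2)) * u 2 =
      (η 2 - (ξx 2 0 * u 0 + ξx 2 1 * u 1 + ξx 2 2 * u 2)) * u 1 := by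
    linear_combination u 2 * e01a - u 1 * e02a
  -- The symmetric part of `T` is the strain of ξ, the antisymmetric part measures whether the
  -- pressure derivatives `ηu · 3` are parallel to B. Showing its off-diagonal entries to be zero
  -- gives both statements at once.
  obtain ⟨T, hT⟩ : ∃ T : Fin 3 → Fin 3 → ℝ, ∀ k i, T k i = ξx k i + ξx i k
      - u k.castSucc * ηu i.castSucc 3 + ηu k.castSucc 3 * u i.castSucc := ⟨_, fun _ _ => rfl⟩
  have T01 : T 0 1 = ξx 0 1 + ξx 1 0 - u 0 * ηu 1 3 + ηu 0 3 * u 1 := hT 0 1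
  have T10 : T 1 0 = ξx 1 0 + ξx 0 1 - u 1 * ηu 0 3 + ηu 1 3 * u 0 := hT 1 0
  have T02 : T 0 2 = ξx 0 2 + ξx 2 0 - u 0 * ηu 2 3 + ηu 0 3 * u 2 := hT 0 2
  have T20 : T 2 0 = ξx 2 0 + ξx 0 2 - u 2 * ηu 0 3 + ηu 2 3 * u 0 := hT 2 0
  have T12 : T 1 2 = ξx 1 2 + ξx 2 1 - u 1 * ηu 2 3 + ηu 1 3 * u 2 := hT 1 2
  have T21 : T 2 1 = ξx 2 1 + ξx 1 2 - u 2 * ηu 1 3 + ηu 2 3 * u 1 := hT 2 1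
  have t012 : u 2 * T 0 1 = 0 := by rw [T01]; linear_combination e12a
  have t021 : u 1 * T 0 2 = 0 := by rw [T02]; linear_combination e21a
  have t102 : u 2 * T 1 0 = 0 := by rw [T10]; linear_combination e02b
  have t120 : u 0 * T 1 2 = 0 := by rw [T12]; linear_combination e20b
  have t201 : u 1 * T 2 0 = 0 := by rw [T20]; linear_combination e01c
  have t210 : u 0 * T 2 1 = 0 := by rw [T21]; linear_combination e10c
  have r0 : u 1 * T 1 0 = u 2 * T 2 0 := by
    rw [T10, T20]; linear_combination e01b - e02c
  have r1 : u 0 * T 0 1 = u 2 * T 2 1 := by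
    rw [T01, T21]; linear_combination e10a - e12c
  have r2 : u 0 * T 0 2 = u 1 * T 1 2 := by
    rw [T02, T12]; linear_combination e20a - e21b
  have d1 : u 0 * T 1 0 = u 2 * T 1 2 := by rw [T10, T12]; linear_combination e00b
  have d0 : u 1 * T 0 1 = u 2 * T 0 2 := by rw [T01, T02]; linear_combination e11a
  have d2 : u 0 * T 2 0 = u 1 * T 2 1 := by rw [T20, T21]; linear_combination e00c - e11c
  have z : T 0 1 = 0 ∧ T 1 0 = 0 ∧ T 0 2 = 0 ∧ T 2 0 = 0 ∧ T 1 2 = 0 ∧ T 2 1 = 0 := by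
    clear e00a e00b e00c e11a e11b e11c e01a e01b e01c e02a e02b e02c e10a e10b e10c e12a e12b e12c
      e20a e20b e20c e21a e21b e21c T01 T10 T02 T20 T12 T21 s01 s02 s12 hT
    rcases hu with hu | hu | hu
    · have a1 := (mul_eq_zero.1 t120).resolve_left hu
      have a2 := (mul_eq_zero.1 t210).resolve_left hu
      refine ⟨?_, ?_, ?_, ?_, a1, a2⟩ <;> refine (mul_eq_zero.1 (?_ : u 0 * _ = 0)).resolve_left hu
      · rw [r1, a2, mul_zero]
      · rw [d1, a1, mul_zero]
      · rw [r2, a1, mul_zero]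
      · rw [d2, a2, mul_zero]
    · have a1 := (mul_eq_zero.1 t021).resolve_left hu
      have a2 := (mul_eq_zero.1 t201).resolve_left hu
      refine ⟨?_, ?_, a1, a2, ?_, ?_⟩ <;> refine (mul_eq_zero.1 (?_ : u 1 * _ = 0)).resolve_left hu
      · rw [d0, a1, mul_zero]
      · rw [r0, a2, mul_zero]
      · rw [← r2, a1, mul_zero]
      · rw [← d2, a2, mul_zero]
    · have a1 := (mul_eq_zero.1 t012).resolve_left hu
      have a2 := (mul_eq_zero.1 t102).resolve_left hu
      refine ⟨a1, a2, ?_, ?_, ?_, ?_⟩ <;> refine (mul_eq_zero.1 (?_ : u 2 * _ = 0)).resolve_left hu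
      · rw [← d0, a1, mul_zero]
      · rw [← r0, a2, mul_zero]
      · rw [← d1, a2, mul_zero]
      · rw [← r1, a1, mul_zero]
  obtain ⟨z01, z10, z02, z20, z12, z21⟩ := z
  clear t012 t021 t102 t120 t201 t210 r0 r1 r2 d0 d1 d2
  rw [z01] at T01; rw [z10] at T10; rw [z02] at T02; rw [z20] at T20; rw [z12] at T12
  rw [z21] at T21
  have k01 : ξx 0 1 = -ξx 1 0 := by linarith
  have k02 : ξx 0 2 = -ξx 2 0 := by linarith
  have k12 : ξx 1 2 = -ξx 2 1 := by linarith
  have h01 : ηu 0 3 * u 1 = ηu 1 3 * u 0 := by linarith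
  have h02 : ηu 0 3 * u 2 = ηu 2 3 * u 0 := by linarith
  have h12 : ηu 1 3 * u 2 = ηu 2 3 * u 1 := by linarith
  clear T01 T10 T02 T20 T12 T21 hT z01 z10 z02 z20 z12 z21
  -- In `gij` only the term `ξx i i` depends on i, so comparing two values of i at some j with u_j ≠
  -- 0 equates the diagonal entries of `ξx`.
  have g01 : u 1 * (2 * ξx 0 0 + (l - ηu 3 3) - (ηu 0 3 * u 0 + ηu 1 3 * u 1 + ηu 2 3 * u 2)) + (η 1 - (ξx 1 0 * u 0 + ξx 1 1 * u 1 + ξx 1 2 * u 2)) = 0 := by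
    linear_combination e01a
  have g02 : u 2 * (2 * ξx 0 0 + (l - ηu 3 3) - (ηu 0 3 * u 0 + ηu 1 3 * u 1 + ηu 2 3 * u 2)) + (η 2 - (ξx 2 0 * u 0 + ξx 2 1 * u 1 + ξx 2 2 * u 2)) = 0 := by
    linear_combination e02a
  have g10 : u 0 * (2 * ξx 1 1 + (l - ηu 3 3) - (ηu 0 3 * u 0 + ηu 1 3 * u 1 + ηu 2 3 * u 2)) + (η 0 - (ξx 0 0 * u 0 + ξx 0 1 * u 1 + ξx 0 2 * u 2)) = 0 := by
    linear_combination e10b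
  have g12 : u 2 * (2 * ξx 1 1 + (l - ηu 3 3) - (ηu 0 3 * u 0 + ηu 1 3 * u 1 + ηu 2 3 * u 2)) + (η 2 - (ξx 2 0 * u 0 + ξx 2 1 * u 1 + ξx 2 2 * u 2)) = 0 := by
    linear_combination e12b
  have g20 : u 0 * (2 * ξx 2 2 + (l - ηu 3 3) - (ηu 0 3 * u 0 + ηu 1 3 * u 1 + ηu 2 3 * u 2)) + (η 0 - (ξx 0 0 * u 0 + ξx 0 1 * u 1 + ξx 0 2 * u 2)) = 0 := by
    linear_combination e20c
  have g21 : u 1 * (2 * ξx 2 2 + (l - ηu 3 3) - (ηu 0 3 * u 0 + ηu 1 3 * u 1 + ηu 2 3 * u 2)) + (η 1 - (ξx 1 0 * u 0 + ξx 1 1 * u 1 + ξx 1 2 * u 2)) = 0 := by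
    linear_combination e21c
  have p0 : ηu 3 0 = 0 := by linear_combination -e00a - 2 * u 2 * k02 - u 1 * k01 + u 1 * h01
  have p1 : ηu 3 1 = 0 := by linear_combination -e11b - 2 * u 2 * k12 - u 0 * k01 - u 0 * h01
  have p2 : ηu 3 2 = 0 := by linear_combination e00c - u 1 * k12 - 2 * u 0 * k02 - u 1 * h12
  have g00 : u 0 * (2 * ξx 0 0 + (l - ηu 3 3) - (ηu 0 3 * u 0 + ηu 1 3 * u 1 + ηu 2 3 * u 2)) + (η 0 - (ξx 0 0 * u 0 + ξx 0 1 * u 1 + ξx 0 2 * u 2)) = 0 := by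
    linear_combination -e01b - p0 - u 2 * k02 + u 2 * h02
  have g11 : u 1 * (2 * ξx 1 1 + (l - ηu 3 3) - (ηu 0 3 * u 0 + ηu 1 3 * u 1 + ηu 2 3 * u 2)) + (η 1 - (ξx 1 0 * u 0 + ξx 1 1 * u 1 + ξx 1 2 * u 2)) = 0 := by
    linear_combination -e10a - p1 - u 2 * k12 + u 2 * h12
  have g22 : u 2 * (2 * ξx 2 2 + (l - ηu 3 3) - (ηu 0 3 * u 0 + ηu 1 3 * u 1 + ηu 2 3 * u 2)) + (η 2 - (ξx 2 0 * u 0 + ξx 2 1 * u 1 + ξx 2 2 * u 2)) = 0 := by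
    linear_combination -e20a - p2 - u 1 * k12 - u 1 * h12
  have z1 : ξx 1 1 = ξx 0 0 := by
    rcases hu with hu | hu | hu <;> refine mul_left_cancel₀ hu ?_
    · linear_combination (g10 - g00) / 2
    · linear_combination (g11 - g01) / 2
    · linear_combination (g12 - g02) / 2
  have z2 : ξx 2 2 = ξx 0 0 := by
    rcases hu with hu | hu | hu <;> refine mul_left_cancel₀ hu ?_
    · linear_combination (g20 - g00) / 2
    · linear_combination (g21 - g01) / 2
    · linear_combination (g22 - g02) / 2
  exact ⟨k01, k02, k12, z1, z2, h01, h02, h12, s01, s02, s12, p0, p1, p2,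
    by linear_combination -g00 + u 1 * h01 + u 2 * h02,
    by linear_combination -g01 - u 0 * h01 + u 2 * h12,
    by linear_combination -g02 - u 0 * h02 - u 1 * h12⟩

theorem pointRelations (h : ∀ G a, determining u η ηx ηu ξx ξu (slope u G) a = 0)
    (hu : u 0 ≠ 0 ∨ u 1 ≠ 0 ∨ u 2 ≠ 0) : PointRelations u η ηx ηu ξx ξu := by
  obtain ⟨c0, c1, c2, c3⟩ := determining_constant h
  obtain ⟨H01, H10, H02, H20, H12, H21, H11, H22⟩ := determining_div h hu
  obtain ⟨k01, k02, k12, z1, z2, h01, h02, h12, s01, s02, s12, p0, p1, p2, q0, q1, q2⟩ :=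
    determining_momentum h hu
  refine ⟨determining_ξu h hu, ?_, ?_, ?_, ?_, ?_, ?_, ?_, ?_, c0, c1, c2, c3⟩
  · intro i j hij
    fin_cases i <;> fin_cases j <;> simp at hij ⊢ <;> linarith
  · intro i
    fin_cases i <;> simp [z1, z2]
  · intro i j hij
    fin_cases i <;> fin_cases j <;> simp at hij ⊢ <;> linarith
  · intro i
    fin_cases i <;> simp <;> linarith
  · intro i j
    fin_cases i <;> fin_cases j <;> simp <;> linarith
  · intro i j
    simp only [Fin.sum_univ_three]
    fin_cases i <;> fin_cases j <;> simp <;> linarith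
  · intro j
    fin_cases j <;> simpa
  · intro j
    simp only [Fin.sum_univ_three]
    fin_cases j <;> simp <;> linarith

end

end PlasmaEquilibrium

/-! ### Differentiating the algebraic relations along a curve -/

namespace PlasmaEquilibrium

open Filter Topology

/-- The relations obtained from `PointRelations` by differentiation, with `du` the derivative of `u`
and so on. -/
structure DerivRelations (u du η dη : Fin 4 → ℝ) (C dC : Fin 4 → Fin 3 → ℝ)
    (H dH : Fin 4 → Fin 4 → ℝ) (Z dZ : Fin 3 → Fin 3 → ℝ) (dK : Fin 3 → Fin 4 → ℝ) : Prop where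
  ξu_eq : ∀ i k, dK i k = 0
  skew : ∀ i j, i ≠ j → dZ i j + dZ j i = 0
  diag : ∀ i, dZ i i = dZ 0 0
  ηu_off : ∀ i j, i ≠ j → dH i.castSucc j.castSucc = dZ i j
  ηu_diag : ∀ i : Fin 3, dH i.castSucc i.castSucc - dZ i i = dH 0 0 - dZ 0 0
  ηu_pressure : ∀ i j : Fin 3,
    dH i.castSucc 3 * u j.castSucc + H i.castSucc 3 * du j.castSucc
      = dH j.castSucc 3 * u i.castSucc + H j.castSucc 3 * du i.castSucc
  η_parallel : ∀ i j : Fin 3,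
    (dη i.castSucc - ∑ l, (dZ i l * u l.castSucc + Z i l * du l.castSucc)) * u j.castSucc
      + (η i.castSucc - ∑ l, Z i l * u l.castSucc) * du j.castSucc
    = (dη j.castSucc - ∑ l, (dZ j l * u l.castSucc + Z j l * du l.castSucc)) * u i.castSucc
      + (η j.castSucc - ∑ l, Z j l * u l.castSucc) * du i.castSucc
  pressure_u : ∀ j : Fin 3, dH 3 j.castSucc = 0
  pressure_pressure : ∀ j : Fin 3,
    (dH 3 3 - (dH 0 0 - dZ 0 0) - 2 * dZ 0 0) * u j.castSucc
      + (H 3 3 - (H 0 0 - Z 0 0) - 2 * Z 0 0) * du j.castSucc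
    = (dη j.castSucc - ∑ l, (dZ j l * u l.castSucc + Z j l * du l.castSucc))
      - ((2 * u 0 * du 0 + 2 * u 1 * du 1 + 2 * u 2 * du 2) * H j.castSucc 3
      + (u 0 ^ 2 + u 1 ^ 2 + u 2 ^ 2) * dH j.castSucc 3)
  curl0 : ((dC 0 2 - dC 2 0) * u 2 + (C 0 2 - C 2 0) * du 2)
    - ((dC 1 0 - dC 0 1) * u 1 + (C 1 0 - C 0 1) * du 1) = dC 3 0
  curl1 : ((dC 1 0 - dC 0 1) * u 0 + (C 1 0 - C 0 1) * du 0)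
    - ((dC 2 1 - dC 1 2) * u 2 + (C 2 1 - C 1 2) * du 2) = dC 3 1
  curl2 : ((dC 2 1 - dC 1 2) * u 1 + (C 2 1 - C 1 2) * du 1)
    - ((dC 0 2 - dC 2 0) * u 0 + (C 0 2 - C 2 0) * du 0) = dC 3 2
  div : dC 0 0 + dC 1 1 + dC 2 2 = 0

theorem _root_.HasDerivAt.eq_of_eventually {F G : ℝ → ℝ} {a b t : ℝ} (hF : HasDerivAt F a t)
    (hG : HasDerivAt G b t) (h : ∀ᶠ s in 𝓝 t, F s = G s) : a = b :=
  hF.unique (hG.congr_of_eventuallyEq h)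

/-- The relations persist near `t`, so the two sides of each have the same derivative there. -/
theorem DerivRelations.of_eventually {u N : Fin 4 → ℝ → ℝ} {C : Fin 4 → Fin 3 → ℝ → ℝ}
    {H : Fin 4 → Fin 4 → ℝ → ℝ} {Z : Fin 3 → Fin 3 → ℝ → ℝ} {K : Fin 3 → Fin 4 → ℝ → ℝ}
    {du dN : Fin 4 → ℝ} {dC : Fin 4 → Fin 3 → ℝ} {dH : Fin 4 → Fin 4 → ℝ} {dZ : Fin 3 → Fin 3 → ℝ}
    {dK : Fin 3 → Fin 4 → ℝ} {t : ℝ}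
    (hu : ∀ k, HasDerivAt (u k) (du k) t) (hN : ∀ k, HasDerivAt (N k) (dN k) t)
    (hC : ∀ k i, HasDerivAt (C k i) (dC k i) t) (hH : ∀ k l, HasDerivAt (H k l) (dH k l) t)
    (hZ : ∀ i j, HasDerivAt (Z i j) (dZ i j) t) (hK : ∀ i k, HasDerivAt (K i k) (dK i k) t)
    (h : ∀ᶠ s in 𝓝 t, PointRelations (fun k => u k s) (fun k => N k s) (fun k i => C k i s)
      (fun k l => H k l s) (fun i j => Z i j s) (fun i k => K i k s)) :
    DerivRelations (fun k => u k t) du (fun k => N k t) dN (fun k i => C k i t) dC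
      (fun k l => H k l t) dH (fun i j => Z i j t) dZ dK where
  ξu_eq i k := (hK i k).eq_of_eventually (hasDerivAt_const t 0)
    (h.mono fun s hs => congrFun (congrFun hs.ξu_eq i) k)
  skew i j hij := ((hZ i j).fun_add (hZ j i)).eq_of_eventually (hasDerivAt_const t 0)
    (h.mono fun s hs => hs.skew i j hij)
  diag i := (hZ i i).eq_of_eventually (hZ 0 0) (h.mono fun s hs => hs.diag i)
  ηu_off i j hij := (hH _ _).eq_of_eventually (hZ i j) (h.mono fun s hs => hs.ηu_off i j hij)
  ηu_diag i := ((hH _ _).fun_sub (hZ i i)).eq_of_eventually ((hH 0 0).fun_sub (hZ 0 0))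
    (h.mono fun s hs => hs.ηu_diag i)
  ηu_pressure i j := ((hH _ 3).fun_mul (hu _)).eq_of_eventually ((hH _ 3).fun_mul (hu _))
    (h.mono fun s hs => hs.ηu_pressure i j)
  η_parallel i j :=
    (((hN _).fun_sub (HasDerivAt.fun_sum fun l _ => (hZ i l).fun_mul (hu l.castSucc))).fun_mul
      (hu j.castSucc)).eq_of_eventually
    (((hN _).fun_sub (HasDerivAt.fun_sum fun l _ => (hZ j l).fun_mul (hu l.castSucc))).fun_mul
      (hu i.castSucc)) (h.mono fun s hs => hs.η_parallel i j)
  pressure_u j := (hH 3 _).eq_of_eventually (hasDerivAt_const t 0)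
    (h.mono fun s hs => hs.pressure_u j)
  pressure_pressure j := by
    refine _root_.HasDerivAt.eq_of_eventually (((((hH 3 3).fun_sub ((hH 0 0).fun_sub (hZ 0 0))).fun_sub
      ((hZ 0 0).const_mul 2))).fun_mul (hu j.castSucc))
      ((((hN _).fun_sub (HasDerivAt.fun_sum fun l _ => (hZ j l).fun_mul (hu l.castSucc)))).fun_sub
      (HasDerivAt.fun_mul (HasDerivAt.congr_deriv ((((hu 0).fun_pow 2).fun_add ((hu 1).fun_pow 2)).fun_add
        ((hu 2).fun_pow 2)) ?_) (hH j.castSucc 3)))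
      (h.mono fun s hs => hs.pressure_pressure j)
    simp
  curl0 := ((((hC 0 2).fun_sub (hC 2 0)).fun_mul (hu 2)).fun_sub
    (((hC 1 0).fun_sub (hC 0 1)).fun_mul (hu 1))).eq_of_eventually (hC 3 0)
    (h.mono fun s hs => hs.curl0)
  curl1 := ((((hC 1 0).fun_sub (hC 0 1)).fun_mul (hu 0)).fun_sub
    (((hC 2 1).fun_sub (hC 1 2)).fun_mul (hu 2))).eq_of_eventually (hC 3 1)
    (h.mono fun s hs => hs.curl1)
  curl2 := ((((hC 2 1).fun_sub (hC 1 2)).fun_mul (hu 1)).fun_sub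
    (((hC 0 2).fun_sub (hC 2 0)).fun_mul (hu 0))).eq_of_eventually (hC 3 2)
    (h.mono fun s hs => hs.curl2)
  div := (((hC 0 0).fun_add (hC 1 1)).fun_add (hC 2 2)).eq_of_eventually (hasDerivAt_const t 0)
    (h.mono fun s hs => hs.div)

end PlasmaEquilibrium

/-! ### Algebra of the differentiated relations: all second derivatives vanish -/

namespace PlasmaEquilibrium

open Sum

set_option linter.unusedSimpArgs false

/-- The `u`-component of a coordinate direction. -/
def dirU : Fin 3 ⊕ Fin 4 → Fin 4 → ℝ := Sum.elim (fun _ => 0) (fun k => Pi.single k 1)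

section

variable {u η : Fin 4 → ℝ} {N₁ : Fin 4 → Fin 3 ⊕ Fin 4 → ℝ} {X₁ : Fin 3 → Fin 3 ⊕ Fin 4 → ℝ}
  {N₂ : Fin 4 → Fin 3 ⊕ Fin 4 → Fin 3 ⊕ Fin 4 → ℝ}
  {X₂ : Fin 3 → Fin 3 ⊕ Fin 4 → Fin 3 ⊕ Fin 4 → ℝ}

/-- For i ≠ j, ∂η^i/∂B_j equals ∂ξ^i/∂x^j, which does not depend on u. Symmetry covers i = j ≠ m,
and the equal differences in `ηu_diag` cover i = j = m. -/
theorem secondDeriv_field_eq_zero (hN : ∀ k a b, N₂ k a b = N₂ k b a)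
    (hX : ∀ m a b, X₂ m a b = X₂ m b a)
    (hD : ∀ b, DerivRelations u (dirU b) η (fun k => N₁ k b) (fun k i => N₁ k (inl i))
      (fun k i => N₂ k (inl i) b) (fun k l => N₁ k (inr l)) (fun k l => N₂ k (inr l) b)
      (fun i j => X₁ i (inl j)) (fun i j => X₂ i (inl j) b) (fun i k => X₂ i (inr k) b))
    (i j m : Fin 3) : N₂ i.castSucc (inr j.castSucc) (inr m.castSucc) = 0 := by
  have hX0 : ∀ m k b, X₂ m b (inr k) = 0 := fun m k b => by
    rw [hX]; exact (hD b).ξu_eq m k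
  have hoff : ∀ i j m : Fin 3, i ≠ j → N₂ i.castSucc (inr j.castSucc) (inr m.castSucc) = 0 :=
    fun i j m hij => ((hD (inr m.castSucc)).ηu_off i j hij).trans (hX0 _ _ _)
  rcases ne_or_eq i j with hij | rfl
  · exact hoff i j m hij
  rcases ne_or_eq i m with him | rfl
  · rw [hN]; exact hoff i m i him
  obtain ⟨i', hi'⟩ := exists_ne i
  have h1 := (hD (inr i.castSucc)).ηu_diag i
  have h2 := (hD (inr i.castSucc)).ηu_diag i'
  have h3 : N₂ i'.castSucc (inr i'.castSucc) (inr i.castSucc) = 0 := by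
    rw [hN]; exact hoff i' i i' hi'
  simp only [hX0, h3] at h1 h2
  linarith

/-- Differentiating the two parallelism relations in a transverse field direction fixes their
factors: ∂η^j/∂P = Λ u_j and η^j - ∑ (∂ξ^j/∂x^m) u_m = l u_j. -/
theorem pointRelations_deriv (hu : u 0 ≠ 0 ∨ u 1 ≠ 0 ∨ u 2 ≠ 0)
    (hN : ∀ k a b, N₂ k a b = N₂ k b a) (hX : ∀ m a b, X₂ m a b = X₂ m b a)
    (hP : PointRelations u η (fun k i => N₁ k (inl i)) (fun k l => N₁ k (inr l))
      (fun i j => X₁ i (inl j)) (fun i k => X₁ i (inr k)))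
    (hD : ∀ b, DerivRelations u (dirU b) η (fun k => N₁ k b) (fun k i => N₁ k (inl i))
      (fun k i => N₂ k (inl i) b) (fun k l => N₁ k (inr l)) (fun k l => N₂ k (inr l) b)
      (fun i j => X₁ i (inl j)) (fun i j => X₂ i (inl j) b) (fun i k => X₂ i (inr k) b)) :
    (∀ j : Fin 3, N₁ j.castSucc (inr 3) = 0) ∧
    (∀ j : Fin 3, η j.castSucc = ∑ l, X₁ j (inl l) * u l.castSucc
      + (N₁ 0 (inr 0) - X₁ 0 (inl 0)) * u j.castSucc) ∧
    N₁ 3 (inr 3) = 2 * N₁ 0 (inr 0) := by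
  have hX0 : ∀ m k b, X₂ m b (inr k) = 0 := fun m k b => by
    rw [hX]; exact (hD b).ξu_eq m k
  have hBB := secondDeriv_field_eq_zero hN hX hD
  have hoff : ∀ i j : Fin 3, i ≠ j → N₂ i.castSucc (inr 3) (inr j.castSucc) = 0 := fun i j hij => by
    rw [hN]; exact ((hD (inr 3)).ηu_off i j hij).trans (hX0 _ _ _)
  obtain ⟨Λ, hΛ⟩ : ∃ Λ, N₂ 0 (inr 3) (inr 0) = Λ := ⟨_, rfl⟩
  have hdiag : ∀ i : Fin 3, N₂ i.castSucc (inr 3) (inr i.castSucc) = Λ := fun i => by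
    have := (hD (inr 3)).ηu_diag i
    rw [hX0, hX0, hN, hN 0, hΛ] at this
    linarith
  have hP3 : ∀ j : Fin 3, N₂ 3 (inr 3) (inr j.castSucc) = 0 := fun j => by
    rw [hN]; exact (hD (inr 3)).pressure_u j
  have hsingle : ∀ i j : Fin 3, i ≠ j → dirU (inr i.castSucc) j.castSucc = 0 := fun i j hij => by
    simp [dirU, hij.symm]
  have hsame : ∀ i : Fin 3, dirU (inr i.castSucc) i.castSucc = 1 := fun i => by simp [dirU]
  have hh : ∀ j : Fin 3, N₁ j.castSucc (inr 3) = Λ * u j.castSucc := fun j => by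
    obtain ⟨i, hij⟩ := exists_ne j
    have := (hD (inr i.castSucc)).ηu_pressure i j
    rw [hdiag, hsingle i j hij, hoff j i hij.symm, hsame] at this
    linarith
  obtain ⟨l, hl⟩ : ∃ l, N₁ 0 (inr 0) - X₁ 0 (inl 0) = l := ⟨_, rfl⟩
  have hs : ∀ (Z : Fin 3 → ℝ) (i : Fin 3),
      ∑ m : Fin 3, Z m * dirU (inr i.castSucc) m.castSucc = Z i := fun Z i => by
    rw [Finset.sum_eq_single i]
    · rw [hsame, mul_one]
    · intro m _ hm; rw [hsingle i m hm.symm, mul_zero]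
    · simp
  have hψ : ∀ j : Fin 3, η j.castSucc - ∑ m, X₁ j (inl m) * u m.castSucc = l * u j.castSucc :=
    fun j => by
      obtain ⟨i, hij⟩ := exists_ne j
      have := (hD (inr i.castSucc)).η_parallel i j
      simp only [hX0, zero_mul, zero_add, hs, hsingle i j hij, hsame] at this
      have e1 := hP.ηu_diag i
      have e2 := hP.ηu_off j i hij.symm
      rw [e2, e1, hl] at this
      linarith
  have hpp : ∀ j : Fin 3, N₁ 3 (inr 3) - l - 2 * X₁ 0 (inl 0)
      = l - 2 * u j.castSucc * (Λ * u j.castSucc) - (u 0 ^ 2 + u 1 ^ 2 + u 2 ^ 2) * Λ := fun j => by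
    have := (hD (inr j.castSucc)).pressure_pressure j
    have e0 := hBB 0 0 j
    have e1 := hP.ηu_diag j
    have e3 : 2 * u 0 * dirU (inr j.castSucc) 0 + 2 * u 1 * dirU (inr j.castSucc) 1
        + 2 * u 2 * dirU (inr j.castSucc) 2 = 2 * u j.castSucc := by
      fin_cases j <;> simp [dirU]
    simp only [Fin.castSucc_zero] at e0
    simp only [hX0, zero_mul, zero_add, hs, hsame, hP3, hdiag, e0, hh, hl, e3] at this
    simp only [hl] at e1
    linarith
  have hpp' : ∀ j : Fin 3, (N₁ 3 (inr 3) - l - 2 * X₁ 0 (inl 0)) * u j.castSucc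
      = l * u j.castSucc - (u 0 ^ 2 + u 1 ^ 2 + u 2 ^ 2) * (Λ * u j.castSucc) := fun j => by
    have := hP.pressure_pressure j
    simp only [hψ, hh, hl] at this
    exact this
  obtain ⟨j, hj⟩ : ∃ j : Fin 3, u j.castSucc ≠ 0 := by
    rcases hu with h | h | h
    exacts [⟨0, h⟩, ⟨1, h⟩, ⟨2, h⟩]
  -- The pressure relation and its derivative in B_j differ by 2 Λ u_j³ after multiplication of the
  -- latter by u_j.
  have hΛ0 : Λ = 0 := by
    have h1 := hpp' j
    rw [hpp j] at h1
    have h2 : Λ * u j.castSucc ^ 3 = 0 := by linear_combination -h1 / 2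
    exact (mul_eq_zero.1 h2).resolve_right (pow_ne_zero 3 hj)
  refine ⟨fun j => by rw [hh, hΛ0, zero_mul], fun j => by rw [hl]; linarith [hψ j], ?_⟩
  have := hpp 0
  rw [hΛ0] at this
  linarith

/-- The second derivatives of a conformal Killing field in terms of those of its divergence. -/
theorem conformal_second {T : Fin 3 → Fin 3 → Fin 3 → ℝ} (hs : ∀ m i j, T m i j = T m j i)
    (hk : ∀ i j k, i ≠ j → T i j k + T j i k = 0) (hd : ∀ i k, T i i k = T 0 0 k) :
    (∀ i j, T i j i = T 0 0 j) ∧ (∀ i j, i ≠ j → T i j j = -T 0 0 i) ∧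
    T 0 1 2 = 0 ∧ T 0 2 1 = 0 ∧ T 1 0 2 = 0 ∧ T 1 2 0 = 0 ∧ T 2 0 1 = 0 ∧ T 2 1 0 = 0 := by
  have h1 : ∀ i j, T i j i = T 0 0 j := fun i j => by rw [hs, hd]
  refine ⟨h1, fun i j hij => by linarith [hk i j j hij, h1 j i], ?_⟩
  have a := hk 0 1 2 (by decide)
  have b := hk 0 2 1 (by decide)
  have c := hk 1 2 0 (by decide)
  have d := hs 0 1 2
  have e := hs 1 0 2
  have f := hs 2 0 1
  refine ⟨?_, ?_, ?_, ?_, ?_, ?_⟩ <;> linarith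

/-- `hA`, `hB`, `hC` are the derivatives of the conclusions of `pointRelations_deriv`. All unknowns
reduce to the gradient `T 0 0 i` of the dilation factor of ξ and to the gradient `L` of the field
factor; the divergence and curl relations eliminate both. -/
theorem pointRelations_deriv_deriv (hu : u 0 ≠ 0 ∨ u 1 ≠ 0 ∨ u 2 ≠ 0)
    (hN : ∀ k a b, N₂ k a b = N₂ k b a) (hX : ∀ m a b, X₂ m a b = X₂ m b a)
    (hD : ∀ b, DerivRelations u (dirU b) η (fun k => N₁ k b) (fun k i => N₁ k (inl i))
      (fun k i => N₂ k (inl i) b) (fun k l => N₁ k (inr l)) (fun k l => N₂ k (inr l) b)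
      (fun i j => X₁ i (inl j)) (fun i j => X₂ i (inl j) b) (fun i k => X₂ i (inr k) b))
    (hP : PointRelations u η (fun k i => N₁ k (inl i)) (fun k l => N₁ k (inr l))
      (fun i j => X₁ i (inl j)) (fun i k => X₁ i (inr k)))
    (hA : ∀ (j : Fin 3) b, N₂ j.castSucc (inr 3) b = 0)
    (hB : ∀ (j : Fin 3) b, N₁ j.castSucc b =
      ∑ l, (X₂ j (inl l) b * u l.castSucc + X₁ j (inl l) * dirU b l.castSucc)
      + ((N₂ 0 (inr 0) b - X₂ 0 (inl 0) b) * u j.castSucc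
        + (N₁ 0 (inr 0) - X₁ 0 (inl 0)) * dirU b j.castSucc))
    (hC : ∀ b, N₂ 3 (inr 3) b = 2 * N₂ 0 (inr 0) b) :
    (∀ m a b, X₂ m a b = 0) ∧ (∀ k i, N₁ k (inl i) = 0) ∧ ∀ k l b, N₂ k (inr l) b = 0 := by
  have hX0 : ∀ m k b, X₂ m b (inr k) = 0 := fun m k b => by
    rw [hX]; exact (hD b).ξu_eq m k
  have hBB := secondDeriv_field_eq_zero hN hX hD
  have hPu : ∀ (j : Fin 3) b, N₂ 3 (inr j.castSucc) b = 0 := fun j b => (hD b).pressure_u j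
  obtain ⟨T, hT⟩ : ∃ T : Fin 3 → Fin 3 → Fin 3 → ℝ, ∀ m i j, X₂ m (inl i) (inl j) = T m i j :=
    ⟨_, fun _ _ _ => rfl⟩
  have hTs : ∀ m i j, T m i j = T m j i := fun m i j => by rw [← hT, ← hT, hX]
  have hTk : ∀ i j k, i ≠ j → T i j k + T j i k = 0 := fun i j k hij => by
    rw [← hT, ← hT]; exact (hD (inl k)).skew i j hij
  have hTd : ∀ i k, T i i k = T 0 0 k := fun i k => by
    rw [← hT, ← hT]; exact (hD (inl k)).diag i
  obtain ⟨t1, t2, t3⟩ := conformal_second hTs hTk hTd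
  obtain ⟨t012, t021, t102, t120, t201, t210⟩ := t3
  obtain ⟨L, hL⟩ : ∃ L : Fin 3 → ℝ, ∀ i, N₂ 0 (inr 0) (inl i) = T 0 0 i + L i :=
    ⟨fun i => N₂ 0 (inr 0) (inl i) - T 0 0 i, fun i => by ring⟩
  have hoff : ∀ i j k : Fin 3, i ≠ j → N₂ i.castSucc (inl k) (inr j.castSucc) = T i j k :=
    fun i j k hij => by rw [hN, ← hT]; exact (hD (inl k)).ηu_off i j hij
  have hdiag : ∀ i k : Fin 3, N₂ i.castSucc (inl k) (inr i.castSucc) = T 0 0 k + L k :=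
    fun i k => by
      have := (hD (inl k)).ηu_diag i
      rw [hN, hT, hT, hTd, hL] at this
      linarith
  have hx : ∀ k i : Fin 3, N₁ k.castSucc (inl i) = ∑ l, T k l i * u l.castSucc + L i * u k.castSucc :=
    fun k i => by
      rw [hB, hL, hT]
      simp [dirU, hT]
  have o010 : N₂ 0 (inl 0) (inr 1) = T 0 1 0 := hoff 0 1 0 (by decide)
  have o011 : N₂ 0 (inl 1) (inr 1) = T 0 1 1 := hoff 0 1 1 (by decide)
  have o012 : N₂ 0 (inl 2) (inr 1) = T 0 1 2 := hoff 0 1 2 (by decide)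
  have o020 : N₂ 0 (inl 0) (inr 2) = T 0 2 0 := hoff 0 2 0 (by decide)
  have o021 : N₂ 0 (inl 1) (inr 2) = T 0 2 1 := hoff 0 2 1 (by decide)
  have o022 : N₂ 0 (inl 2) (inr 2) = T 0 2 2 := hoff 0 2 2 (by decide)
  have o100 : N₂ 1 (inl 0) (inr 0) = T 1 0 0 := hoff 1 0 0 (by decide)
  have o101 : N₂ 1 (inl 1) (inr 0) = T 1 0 1 := hoff 1 0 1 (by decide)
  have o102 : N₂ 1 (inl 2) (inr 0) = T 1 0 2 := hoff 1 0 2 (by decide)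
  have o120 : N₂ 1 (inl 0) (inr 2) = T 1 2 0 := hoff 1 2 0 (by decide)
  have o121 : N₂ 1 (inl 1) (inr 2) = T 1 2 1 := hoff 1 2 1 (by decide)
  have o122 : N₂ 1 (inl 2) (inr 2) = T 1 2 2 := hoff 1 2 2 (by decide)
  have o200 : N₂ 2 (inl 0) (inr 0) = T 2 0 0 := hoff 2 0 0 (by decide)
  have o201 : N₂ 2 (inl 1) (inr 0) = T 2 0 1 := hoff 2 0 1 (by decide)
  have o202 : N₂ 2 (inl 2) (inr 0) = T 2 0 2 := hoff 2 0 2 (by decide)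
  have o210 : N₂ 2 (inl 0) (inr 1) = T 2 1 0 := hoff 2 1 0 (by decide)
  have o211 : N₂ 2 (inl 1) (inr 1) = T 2 1 1 := hoff 2 1 1 (by decide)
  have o212 : N₂ 2 (inl 2) (inr 1) = T 2 1 2 := hoff 2 1 2 (by decide)
  have i10 : N₂ 1 (inl 0) (inr 1) = T 0 0 0 + L 0 := hdiag 1 0
  have i11 : N₂ 1 (inl 1) (inr 1) = T 0 0 1 + L 1 := hdiag 1 1
  have i12 : N₂ 1 (inl 2) (inr 1) = T 0 0 2 + L 2 := hdiag 1 2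
  have i20 : N₂ 2 (inl 0) (inr 2) = T 0 0 0 + L 0 := hdiag 2 0
  have i21 : N₂ 2 (inl 1) (inr 2) = T 0 0 1 + L 1 := hdiag 2 1
  have i22 : N₂ 2 (inl 2) (inr 2) = T 0 0 2 + L 2 := hdiag 2 2
  have i00 : N₂ 0 (inl 0) (inr 0) = T 0 0 0 + L 0 := hdiag 0 0
  have i01 : N₂ 0 (inl 1) (inr 0) = T 0 0 1 + L 1 := hdiag 0 1
  have i02 : N₂ 0 (inl 2) (inr 0) = T 0 0 2 + L 2 := hdiag 0 2
  have x00 : N₁ 0 (inl 0) = T 0 0 0 * u 0 + T 0 1 0 * u 1 + T 0 2 0 * u 2 + L 0 * u 0 :=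
    (hx 0 0).trans (by simp [Fin.sum_univ_three])
  have x01 : N₁ 0 (inl 1) = T 0 0 1 * u 0 + T 0 1 1 * u 1 + T 0 2 1 * u 2 + L 1 * u 0 :=
    (hx 0 1).trans (by simp [Fin.sum_univ_three])
  have x02 : N₁ 0 (inl 2) = T 0 0 2 * u 0 + T 0 1 2 * u 1 + T 0 2 2 * u 2 + L 2 * u 0 :=
    (hx 0 2).trans (by simp [Fin.sum_univ_three])
  have x10 : N₁ 1 (inl 0) = T 1 0 0 * u 0 + T 1 1 0 * u 1 + T 1 2 0 * u 2 + L 0 * u 1 :=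
    (hx 1 0).trans (by simp [Fin.sum_univ_three])
  have x11 : N₁ 1 (inl 1) = T 1 0 1 * u 0 + T 1 1 1 * u 1 + T 1 2 1 * u 2 + L 1 * u 1 :=
    (hx 1 1).trans (by simp [Fin.sum_univ_three])
  have x12 : N₁ 1 (inl 2) = T 1 0 2 * u 0 + T 1 1 2 * u 1 + T 1 2 2 * u 2 + L 2 * u 1 :=
    (hx 1 2).trans (by simp [Fin.sum_univ_three])
  have x20 : N₁ 2 (inl 0) = T 2 0 0 * u 0 + T 2 1 0 * u 1 + T 2 2 0 * u 2 + L 0 * u 2 :=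
    (hx 2 0).trans (by simp [Fin.sum_univ_three])
  have x21 : N₁ 2 (inl 1) = T 2 0 1 * u 0 + T 2 1 1 * u 1 + T 2 2 1 * u 2 + L 1 * u 2 :=
    (hx 2 1).trans (by simp [Fin.sum_univ_three])
  have x22 : N₁ 2 (inl 2) = T 2 0 2 * u 0 + T 2 1 2 * u 1 + T 2 2 2 * u 2 + L 2 * u 2 :=
    (hx 2 2).trans (by simp [Fin.sum_univ_three])
  have T010 : T 0 1 0 = T 0 0 1 := t1 0 1
  have T011 : T 0 1 1 = -T 0 0 0 := t2 0 1 (by decide)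
  have T020 : T 0 2 0 = T 0 0 2 := t1 0 2
  have T022 : T 0 2 2 = -T 0 0 0 := t2 0 2 (by decide)
  have T100 : T 1 0 0 = -T 0 0 1 := t2 1 0 (by decide)
  have T101 : T 1 0 1 = T 0 0 0 := t1 1 0
  have T110 : T 1 1 0 = T 0 0 0 := hTd 1 0
  have T111 : T 1 1 1 = T 0 0 1 := hTd 1 1
  have T112 : T 1 1 2 = T 0 0 2 := hTd 1 2
  have T121 : T 1 2 1 = T 0 0 2 := t1 1 2
  have T122 : T 1 2 2 = -T 0 0 1 := t2 1 2 (by decide)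
  have T200 : T 2 0 0 = -T 0 0 2 := t2 2 0 (by decide)
  have T202 : T 2 0 2 = T 0 0 0 := t1 2 0
  have T211 : T 2 1 1 = -T 0 0 2 := t2 2 1 (by decide)
  have T212 : T 2 1 2 = T 0 0 1 := t1 2 1
  have T220 : T 2 2 0 = T 0 0 0 := hTd 2 0
  have T221 : T 2 2 1 = T 0 0 1 := hTd 2 1
  have T222 : T 2 2 2 = T 0 0 2 := hTd 2 2
  have v0 := (hD (inr 0)).div
  have v1 := (hD (inr 1)).div
  have v2 := (hD (inr 2)).div
  simp only [o010, o011, o012, o020, o021, o022, o100, o101, o102, o120, o121, o122, o200, o201,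
    o202, o210, o211, o212, i00, i01, i02, i10, i11, i12, i20, i21, i22,
    T010, T011, t012, T020, t021, T022, T100, T101, t102, T110, T111, T112, t120, T121,
    T122, T200, t201, T202, t210, T211, T212, T220, T221, T222] at v0 v1 v2
  -- The derivative of the divergence relation in B_i reads 3 `T 0 0 i` + `L i` = 0.
  have L0 : L 0 = -3 * T 0 0 0 := by linarith
  have L1 : L 1 = -3 * T 0 0 1 := by linarith
  have L2 : L 2 = -3 * T 0 0 2 := by linarith
  have c00 := (hD (inr 0)).curl0
  have c01 := (hD (inr 1)).curl0
  have c02 := (hD (inr 2)).curl0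
  have c10 := (hD (inr 0)).curl1
  have c11 := (hD (inr 1)).curl1
  have c12 := (hD (inr 2)).curl1
  have c20 := (hD (inr 0)).curl2
  have c21 := (hD (inr 1)).curl2
  have c22 := (hD (inr 2)).curl2
  have P0 : ∀ i, N₂ 3 (inl i) (inr 0) = 0 := fun i => by rw [hN]; exact hPu 0 _
  have P1 : ∀ i, N₂ 3 (inl i) (inr 1) = 0 := fun i => by rw [hN]; exact hPu 1 _
  have P2 : ∀ i, N₂ 3 (inl i) (inr 2) = 0 := fun i => by rw [hN]; exact hPu 2 _
  have hd : ∀ k l : Fin 4, dirU (inr k) l = if l = k then 1 else 0 := fun k l => by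
    simp [dirU, Pi.single_apply]
  simp only [P0, P1, P2, hd,
    o010, o011, o012, o020, o021, o022, o100, o101, o102, o120, o121, o122, o200, o201,
    o202, o210, o211, o212, i00, i01, i02, i10, i11, i12, i20, i21, i22,
    x00, x01, x02, x10, x11, x12, x20, x21, x22,
    T010, T011, t012, T020, t021, T022, T100, T101, t102, T110, T111, T112, t120, T121,
    T122, T200, t201, T202, t210, T211, T212, T220, T221, T222,
    L0, L1, L2] at c00 c01 c02 c10 c11 c12 c20 c21 c22
  simp at c00 c01 c02 c10 c11 c12 c20 c21 c22
  -- The nine field derivatives of the curl relations are linear in these products; this step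
  -- removes the special conformal fields.
  have hr : ∀ i j : Fin 3, T 0 0 i * u j.castSucc = 0 := by
    intro i j
    fin_cases i <;> fin_cases j <;> simp only [Fin.zero_eta, Fin.mk_one, Fin.reduceFinMk,
      Fin.castSucc_zero, Fin.castSucc_one, Fin.reduceCastSucc] <;> linarith
  obtain ⟨j, hj⟩ : ∃ j : Fin 3, u j.castSucc ≠ 0 := by
    rcases hu with h | h | h
    exacts [⟨0, h⟩, ⟨1, h⟩, ⟨2, h⟩]
  have hr0 : ∀ i, T 0 0 i = 0 := fun i => (mul_eq_zero.1 (hr i j)).resolve_right hj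
  clear c00 c01 c02 c10 c11 c12 c20 c21 c22
  have hT0 : ∀ m i j, T m i j = 0 := by
    intro m i j
    fin_cases m <;> fin_cases i <;> fin_cases j <;> simp [hr0, T010, T011, t012, T020, t021, T022, T100, T101, t102, T110, T111, T112, t120, T121,
      T122, T200, t201, T202, t210, T211, T212, T220, T221, T222]
  have hL0 : ∀ i, L i = 0 := by
    intro i
    fin_cases i <;> simp [L0, L1, L2, hr0]
  have hX2 : ∀ m a b, X₂ m a b = 0 := by
    rintro m (a | a) (b | b)
    · rw [hT, hT0]
    · exact hX0 _ _ _
    · rw [hX]; exact hX0 _ _ _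
    · exact hX0 _ _ _
  have hN1 : ∀ (k i : Fin 3), N₁ k.castSucc (inl i) = 0 := fun k i => by
    rw [hx]; simp [hT0, hL0]
  have hN0 : ∀ (k l : Fin 3) b, N₂ k.castSucc (inr l.castSucc) b = 0 := by
    rintro k l (b | b)
    · rw [hN]
      rcases ne_or_eq k l with hkl | rfl
      · rw [hoff k l b hkl, hT0]
      · rw [hdiag, hT0, hL0, zero_add]
    · induction b using Fin.lastCases with
      | last => rw [hN]; exact hA k _
      | cast b => exact hBB k l b
  refine ⟨hX2, fun k i => ?_, fun k l b => ?_⟩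
  · induction k using Fin.lastCases with
    | cast k => exact hN1 k i
    | last =>
      have e0 := hP.curl0
      have e1 := hP.curl1
      have e2 := hP.curl2
      have n0 : ∀ i, N₁ 0 (inl i) = 0 := hN1 0
      have n1 : ∀ i, N₁ 1 (inl i) = 0 := hN1 1
      have n2 : ∀ i, N₁ 2 (inl i) = 0 := hN1 2
      simp only [n0, n1, n2] at e0 e1 e2
      change N₁ 3 (inl i) = 0
      fin_cases i <;> simp <;> linarith
  · induction k using Fin.lastCases with
    | cast k =>
      induction l using Fin.lastCases with
      | cast l => exact hN0 k l b
      | last => exact hA k b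
    | last =>
      induction l using Fin.lastCases with
      | cast l => exact hPu l b
      | last => exact (hC b).trans (by rw [show N₂ 0 (inr 0) b = 0 from hN0 0 0 b, mul_zero])

end

end PlasmaEquilibrium

/-! ### From the algebra to functions on a ball -/

namespace PlasmaEquilibrium

open Sum Filter Topology

/-- The coordinate directions of the space of the variables `𝐱` and `𝐮`. -/
def dir : Fin 3 ⊕ Fin 4 → (Fin 3 → ℝ) × (Fin 4 → ℝ) :=
  Sum.elim (fun i => (Pi.single i 1, 0)) (fun k => (0, Pi.single k 1))

theorem dir_snd (a : Fin 3 ⊕ Fin 4) : (dir a).2 = dirU a := by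
  rcases a with a | a
  · rfl
  · rfl

theorem eq_sum_dir (v : (Fin 3 → ℝ) × (Fin 4 → ℝ)) :
    v = ∑ i, v.1 i • dir (inl i) + ∑ k, v.2 k • dir (inr k) := by
  refine Prod.ext ?_ ?_
  · funext i
    fin_cases i <;> simp [dir, Fin.sum_univ_succ]
  · funext i
    fin_cases i <;> simp [dir, Fin.sum_univ_succ]

theorem clm_apply_dir (L : (Fin 3 → ℝ) × (Fin 4 → ℝ) →L[ℝ] ℝ) (v : (Fin 3 → ℝ) × (Fin 4 → ℝ)) :
    L v = ∑ i, v.1 i * L (dir (inl i)) + ∑ k, v.2 k * L (dir (inr k)) := by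
  conv_lhs => rw [eq_sum_dir v]
  simp only [map_add, map_sum, map_smul, smul_eq_mul]

theorem clm_ext_dir {F : Type*} [NormedAddCommGroup F] [NormedSpace ℝ F]
    {L L' : (Fin 3 → ℝ) × (Fin 4 → ℝ) →L[ℝ] F} (h : ∀ a, L (dir a) = L' (dir a)) : L = L' := by
  refine ContinuousLinearMap.ext fun v => ?_
  rw [eq_sum_dir v]
  simp only [map_add, map_sum, map_smul, h]

/-- The second derivatives in coordinate directions. -/
noncomputable def secondDeriv (f : (Fin 3 → ℝ) × (Fin 4 → ℝ) → ℝ) (y : (Fin 3 → ℝ) × (Fin 4 → ℝ))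
    (a b : Fin 3 ⊕ Fin 4) : ℝ :=
  fderiv ℝ (fun y' => fderiv ℝ f y' (dir a)) y (dir b)

section

variable {f : (Fin 3 → ℝ) × (Fin 4 → ℝ) → ℝ} {y : (Fin 3 → ℝ) × (Fin 4 → ℝ)}
  (hf : ContDiffAt ℝ ∞ f y)

include hf

theorem contDiffAt_fderiv : ContDiffAt ℝ ∞ (fderiv ℝ f) y :=
  hf.fderiv_right (by simp)

theorem secondDeriv_eq (a b : Fin 3 ⊕ Fin 4) :
    secondDeriv f y a b = fderiv ℝ (fderiv ℝ f) y (dir b) (dir a) := by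
  have h := ((contDiffAt_fderiv hf).differentiableAt (by simp)).hasFDerivAt.clm_apply
    (hasFDerivAt_const (dir a) y)
  rw [secondDeriv, h.fderiv]
  simp

theorem secondDeriv_symm (a b : Fin 3 ⊕ Fin 4) : secondDeriv f y a b = secondDeriv f y b a := by
  rw [secondDeriv_eq hf, secondDeriv_eq hf]
  refine hf.isSymmSndFDerivAt ?_ _ _
  rw [minSmoothness_of_isRCLikeNormedField]; exact WithTop.coe_le_coe.2 le_top

theorem hasDerivAt_line (v : (Fin 3 → ℝ) × (Fin 4 → ℝ)) :
    HasDerivAt (fun t : ℝ => f (y + t • v)) (fderiv ℝ f y v) 0 :=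
  (hf.differentiableAt (by simp)).hasFDerivAt.hasLineDerivAt v

theorem hasDerivAt_line_fderiv (a b : Fin 3 ⊕ Fin 4) :
    HasDerivAt (fun t : ℝ => fderiv ℝ f (y + t • dir b) (dir a)) (secondDeriv f y a b) 0 :=
  hasDerivAt_line (f := fun y' => fderiv ℝ f y' (dir a))
    ((contDiffAt_fderiv hf).clm_apply contDiffAt_const) (dir b)

theorem fderiv_fderiv_eq_zero (h : ∀ a b, secondDeriv f y a b = 0) :
    fderiv ℝ (fderiv ℝ f) y = 0 := by
  refine clm_ext_dir fun b => clm_ext_dir fun a => ?_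
  rw [← secondDeriv_eq hf, h]
  rfl

end

theorem hasDerivAt_line_snd (y : (Fin 3 → ℝ) × (Fin 4 → ℝ)) (b : Fin 3 ⊕ Fin 4) (k : Fin 4) :
    HasDerivAt (fun t : ℝ => (y + t • dir b).2 k) (dirU b k) 0 := by
  have := ((hasDerivAt_id (0 : ℝ)).mul_const (dirU b k)).const_add (y.2 k)
  simpa [dir_snd] using this

/-- The base point `y₁` is kept separate from the centre so that it can be taken where the field is
non-zero. -/
theorem eq_affine_of_secondDeriv {f : (Fin 3 → ℝ) × (Fin 4 → ℝ) → ℝ}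
    {y₀ y₁ : (Fin 3 → ℝ) × (Fin 4 → ℝ)} {ε : ℝ} (hy₁ : y₁ ∈ Metric.ball y₀ ε)
    (hf : ∀ y ∈ Metric.ball y₀ ε, ContDiffAt ℝ ∞ f y)
    (h : ∀ y ∈ Metric.ball y₀ ε, ∀ a b, secondDeriv f y a b = 0) :
    ∀ y ∈ Metric.ball y₀ ε, f y = f y₁ + fderiv ℝ f y₁ (y - y₁) := by
  have hc := (convex_ball y₀ ε).isPreconnected
  have hd : ∀ y ∈ Metric.ball y₀ ε, fderiv ℝ f y = fderiv ℝ f y₁ := fun y hy =>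
    Metric.isOpen_ball.is_const_of_fderiv_eq_zero (𝕜 := ℝ) hc
      (fun z hz => ((contDiffAt_fderiv (hf z hz)).differentiableAt (by simp)).differentiableWithinAt)
      (fun z hz => fderiv_fderiv_eq_zero (hf z hz) (h z hz)) hy hy₁
  refine Metric.isOpen_ball.eqOn_of_fderiv_eq (𝕜 := ℝ) hc
    (fun z hz => ((hf z hz).differentiableAt (by simp)).differentiableWithinAt) (by fun_prop)
    (fun z hz => ?_) hy₁ (by simp)
  rw [hd z hz]
  refine ContinuousLinearMap.ext fun v => ?_
  have := ((fderiv ℝ f y₁).hasFDerivAt.comp z ((hasFDerivAt_id z).sub_const y₁)).const_add (f y₁)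
  rw [HasFDerivAt.fderiv (f := fun y => f y₁ + fderiv ℝ f y₁ (y - y₁)) this]
  simp

/-- The magnetic field does not vanish. -/
def FieldNe (y : (Fin 3 → ℝ) × (Fin 4 → ℝ)) : Prop := y.2 0 ≠ 0 ∨ y.2 1 ≠ 0 ∨ y.2 2 ≠ 0

theorem isOpen_fieldNe : IsOpen {y | FieldNe y} := by
  unfold FieldNe
  refine (isOpen_ne_fun ?_ ?_).union ((isOpen_ne_fun ?_ ?_).union (isOpen_ne_fun ?_ ?_)) <;> fun_prop

theorem fieldNe_line {y : (Fin 3 → ℝ) × (Fin 4 → ℝ)} (hy : ¬ FieldNe y) {t : ℝ} (ht : t ≠ 0) :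
    FieldNe (y + t • dir (inr 0)) := by
  left
  simp only [FieldNe, not_or, not_not] at hy
  simpa [dir, hy.1] using ht

section

variable {ξ : Fin 3 → (Fin 3 → ℝ) × (Fin 4 → ℝ) → ℝ} {η : Fin 4 → (Fin 3 → ℝ) × (Fin 4 → ℝ) → ℝ}

theorem IsPointSymmetryAt.pointRelations {y : (Fin 3 → ℝ) × (Fin 4 → ℝ)}
    (h : IsPointSymmetryAt ξ η y) (hy : FieldNe y) :
    PointRelations y.2 (fun k => η k y) (fun k i => fderiv ℝ (η k) y (dir (inl i)))
      (fun k l => fderiv ℝ (η k) y (dir (inr l))) (fun m i => fderiv ℝ (ξ m) y (dir (inl i)))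
      (fun m l => fderiv ℝ (ξ m) y (dir (inr l))) := by
  refine PlasmaEquilibrium.pointRelations (fun G a => ?_) hy
  rw [← h G a, determining]
  congr 1
  funext k i
  have hs : ∀ (i : Fin 3) (F : Fin 3 → ℝ), ∑ j, (Pi.single i 1 : Fin 3 → ℝ) j * F j = F i := by
    intro i F
    simp [Pi.single_apply]
  simp only [pointProlongation, clm_apply_dir (fderiv ℝ (η k) y) (Pi.single i 1, _),
    fun m => clm_apply_dir (fderiv ℝ (ξ m) y) (Pi.single i 1, fun l => slope y.2 G l i), hs]

variable {U : Set ((Fin 3 → ℝ) × (Fin 4 → ℝ))} (hU : IsOpen U)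
  (hξ : ∀ m, ∀ y ∈ U, ContDiffAt ℝ ∞ (ξ m) y) (hη : ∀ k, ∀ y ∈ U, ContDiffAt ℝ ∞ (η k) y)
  (h : ∀ y ∈ U, IsPointSymmetryAt ξ η y)

include hU hξ hη h

theorem derivRelations {y : (Fin 3 → ℝ) × (Fin 4 → ℝ)} (hyU : y ∈ U) (hy : FieldNe y)
    (b : Fin 3 ⊕ Fin 4) :
    DerivRelations y.2 (dirU b) (fun k => η k y) (fun k => fderiv ℝ (η k) y (dir b))
      (fun k i => fderiv ℝ (η k) y (dir (inl i))) (fun k i => secondDeriv (η k) y (inl i) b)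
      (fun k l => fderiv ℝ (η k) y (dir (inr l))) (fun k l => secondDeriv (η k) y (inr l) b)
      (fun i j => fderiv ℝ (ξ i) y (dir (inl j))) (fun i j => secondDeriv (ξ i) y (inl j) b)
      (fun i k => secondDeriv (ξ i) y (inr k) b) := by
  have hc : Tendsto (fun t : ℝ => y + t • dir b) (𝓝 0) (𝓝 y) := by
    have : Continuous fun t : ℝ => y + t • dir b := by fun_prop
    simpa using this.tendsto 0
  have := DerivRelations.of_eventually (t := 0) (fun k => hasDerivAt_line_snd y b k)
    (fun k => hasDerivAt_line (hη k y hyU) (dir b))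
    (fun k i => hasDerivAt_line_fderiv (hη k y hyU) (inl i) b)
    (fun k l => hasDerivAt_line_fderiv (hη k y hyU) (inr l) b)
    (fun i j => hasDerivAt_line_fderiv (hξ i y hyU) (inl j) b)
    (fun i k => hasDerivAt_line_fderiv (hξ i y hyU) (inr k) b)
    (by
      filter_upwards [hc.eventually (hU.mem_nhds hyU), hc.eventually (isOpen_fieldNe.mem_nhds hy)]
        with t h1 h2
      exact (h _ h1).pointRelations h2)
  simpa using this

theorem pointRelations_first {y : (Fin 3 → ℝ) × (Fin 4 → ℝ)} (hyU : y ∈ U) (hy : FieldNe y) :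
    (∀ j : Fin 3, fderiv ℝ (η j.castSucc) y (dir (inr 3)) = 0) ∧
    (∀ j : Fin 3, η j.castSucc y = ∑ l, fderiv ℝ (ξ j) y (dir (inl l)) * y.2 l.castSucc
      + (fderiv ℝ (η 0) y (dir (inr 0)) - fderiv ℝ (ξ 0) y (dir (inl 0))) * y.2 j.castSucc) ∧
    fderiv ℝ (η 3) y (dir (inr 3)) = 2 * fderiv ℝ (η 0) y (dir (inr 0)) :=
  pointRelations_deriv (N₁ := fun k a => fderiv ℝ (η k) y (dir a))
    (X₁ := fun k a => fderiv ℝ (ξ k) y (dir a)) (N₂ := fun k => secondDeriv (η k) y)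
    (X₂ := fun k => secondDeriv (ξ k) y) hy (fun k a b => secondDeriv_symm (hη k y hyU) a b)
    (fun k a b => secondDeriv_symm (hξ k y hyU) a b) ((h y hyU).pointRelations hy)
    (fun b => derivRelations hU hξ hη h hyU hy b)

theorem pointRelations_second {y : (Fin 3 → ℝ) × (Fin 4 → ℝ)} (hyU : y ∈ U) (hy : FieldNe y) :
    (∀ m a b, secondDeriv (ξ m) y a b = 0) ∧ (∀ k i, fderiv ℝ (η k) y (dir (inl i)) = 0) ∧
      ∀ k l b, secondDeriv (η k) y (inr l) b = 0 := by
  have hc : ∀ b, ∀ᶠ t in 𝓝 (0 : ℝ), y + t • dir b ∈ U ∧ FieldNe (y + t • dir b) := fun b => by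
    have hc : Tendsto (fun t : ℝ => y + t • dir b) (𝓝 0) (𝓝 y) := by
      have : Continuous fun t : ℝ => y + t • dir b := by fun_prop
      simpa using this.tendsto 0
    exact (hc.eventually (hU.mem_nhds hyU)).and (hc.eventually (isOpen_fieldNe.mem_nhds hy))
  refine pointRelations_deriv_deriv (N₁ := fun k a => fderiv ℝ (η k) y (dir a))
    (X₁ := fun k a => fderiv ℝ (ξ k) y (dir a)) (N₂ := fun k => secondDeriv (η k) y)
    (X₂ := fun k => secondDeriv (ξ k) y) hy (fun k a b => secondDeriv_symm (hη k y hyU) a b)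
    (fun k a b => secondDeriv_symm (hξ k y hyU) a b)
    (fun b => derivRelations hU hξ hη h hyU hy b) ((h y hyU).pointRelations hy) ?_ ?_ ?_
  · intro j b
    exact (hasDerivAt_line_fderiv (hη _ y hyU) (inr 3) b).eq_of_eventually (hasDerivAt_const 0 0)
      ((hc b).mono fun t ht => (pointRelations_first hU hξ hη h ht.1 ht.2).1 j)
  · intro j b
    have := (hasDerivAt_line (hη j.castSucc y hyU) (dir b)).eq_of_eventually
      ((HasDerivAt.fun_sum fun l _ => (hasDerivAt_line_fderiv (hξ j y hyU) (inl l) b).fun_mul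
        (hasDerivAt_line_snd y b l.castSucc)).fun_add
        (((hasDerivAt_line_fderiv (hη 0 y hyU) (inr 0) b).fun_sub
          (hasDerivAt_line_fderiv (hξ 0 y hyU) (inl 0) b)).fun_mul
          (hasDerivAt_line_snd y b j.castSucc)))
      ((hc b).mono fun t ht => (pointRelations_first hU hξ hη h ht.1 ht.2).2.1 j)
    simpa using this
  · intro b
    exact (hasDerivAt_line_fderiv (hη 3 y hyU) (inr 3) b).eq_of_eventually
      ((hasDerivAt_line_fderiv (hη 0 y hyU) (inr 0) b).const_mul 2)
      ((hc b).mono fun t ht => (pointRelations_first hU hξ hη h ht.1 ht.2).2.2)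

theorem secondDeriv_η_eq_zero_of_fieldNe {y : (Fin 3 → ℝ) × (Fin 4 → ℝ)} (hyU : y ∈ U)
    (hy : FieldNe y) (k : Fin 4) (a b : Fin 3 ⊕ Fin 4) : secondDeriv (η k) y a b = 0 := by
  rcases a with a | a
  -- The x-derivatives of η vanish at all nearby points with non-zero field, hence so do their own
  -- derivatives.
  · have hc : Tendsto (fun t : ℝ => y + t • dir b) (𝓝 0) (𝓝 y) := by
      have : Continuous fun t : ℝ => y + t • dir b := by fun_prop
      simpa using this.tendsto 0
    refine (hasDerivAt_line_fderiv (hη k y hyU) (inl a) b).eq_of_eventually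
      (hasDerivAt_const (0 : ℝ) (0 : ℝ)) ?_
    filter_upwards [hc.eventually (hU.mem_nhds hyU), hc.eventually (isOpen_fieldNe.mem_nhds hy)]
      with t h1 h2
    exact (pointRelations_second hU hξ hη h h1 h2).2.1 k a
  · exact (pointRelations_second hU hξ hη h hyU hy).2.2 k a b

omit hξ hη h in
theorem secondDeriv_eq_zero_of_dense {f : (Fin 3 → ℝ) × (Fin 4 → ℝ) → ℝ}
    (hf : ∀ y ∈ U, ContDiffAt ℝ ∞ f y)
    (h0 : ∀ y ∈ U, FieldNe y → ∀ a b, secondDeriv f y a b = 0) :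
    ∀ y ∈ U, ∀ a b, secondDeriv f y a b = 0 := by
  intro y hyU a b
  by_cases hy : FieldNe y
  · exact h0 y hyU hy a b
  have hct : Continuous fun t : ℝ => y + t • dir (inr 0) := by fun_prop
  have hc : Tendsto (fun t : ℝ => y + t • dir (inr 0)) (𝓝 0) (𝓝 y) := by
    simpa using hct.tendsto 0
  have h2 : ContinuousAt (fun y' => secondDeriv f y' a b) y :=
    (((((contDiffAt_fderiv (hf y hyU)).clm_apply contDiffAt_const).fderiv_right (m := 0)
      (by simp)).continuousAt).clm_apply continuousAt_const :)
  have h3 : ContinuousAt (fun t : ℝ => secondDeriv f (y + t • dir (inr 0)) a b) 0 :=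
    ContinuousAt.comp (x := (0 : ℝ)) (f := fun t : ℝ => y + t • dir (inr 0))
      (g := fun y' => secondDeriv f y' a b) (by simpa using h2) hct.continuousAt
  have := eq_zero_of_eventually_punctured h3 (by
    filter_upwards [(hc.eventually (hU.mem_nhds hyU)).filter_mono nhdsWithin_le_nhds,
      self_mem_nhdsWithin] with t h1 ht
    exact h0 _ h1 (fieldNe_line hy ht) a b)
  simpa using this

end

end PlasmaEquilibrium

/-! ### Local normal form and uniqueness of its constants -/

namespace PlasmaEquilibrium

open Sum Filter Topology

/-- The general operator with constants `l₁, l₂, l₃, β, R, α, δ, γ, μ` collected in a vector. -/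
def standardOperator (c : Fin 9 → ℝ) : Generator :=
  plasmaOperator (c 0) (c 1) (c 2) (c 3) (c 4) (c 5) (c 6) (c 7) (c 8)

theorem exists_fieldNe_mem_ball (y₀ : (Fin 3 → ℝ) × (Fin 4 → ℝ)) {ε : ℝ} (hε : 0 < ε) :
    ∃ y ∈ Metric.ball y₀ ε, FieldNe y := by
  by_cases hy : FieldNe y₀
  · exact ⟨y₀, Metric.mem_ball_self hε, hy⟩
  have hc : Tendsto (fun t : ℝ => y₀ + t • dir (inr 0)) (𝓝 0) (𝓝 y₀) := by
    have : Continuous fun t : ℝ => y₀ + t • dir (inr 0) := by fun_prop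
    simpa using this.tendsto 0
  obtain ⟨t, h1, ht⟩ := (((hc.eventually (Metric.ball_mem_nhds y₀ hε)).filter_mono
    nhdsWithin_le_nhds).and (self_mem_nhdsWithin (s := ({0}ᶜ : Set ℝ)))).exists
  exact ⟨_, h1, fieldNe_line hy ht⟩

/-- On a ball, the point symmetries are those of the nine-parameter group. -/
theorem exists_standard_of_isPointSymmetryAt {ξ : Fin 3 → (Fin 3 → ℝ) × (Fin 4 → ℝ) → ℝ}
    {η : Fin 4 → (Fin 3 → ℝ) × (Fin 4 → ℝ) → ℝ} {y₀ : (Fin 3 → ℝ) × (Fin 4 → ℝ)} {ε : ℝ}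
    (hε : 0 < ε) (hξ : ∀ m, ∀ y ∈ Metric.ball y₀ ε, ContDiffAt ℝ ∞ (ξ m) y)
    (hη : ∀ k, ∀ y ∈ Metric.ball y₀ ε, ContDiffAt ℝ ∞ (η k) y)
    (h : ∀ y ∈ Metric.ball y₀ ε, IsPointSymmetryAt ξ η y) :
    ∃ c : Fin 9 → ℝ, ∀ y ∈ Metric.ball y₀ ε, ∀ p : Fin 4 → Fin 3 → ℝ,
      (∀ m, ξ m y = (standardOperator c).ξ (y.1, y.2, p) m) ∧
      ∀ k, η k y = (standardOperator c).η (y.1, y.2, p) k := by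
  have hU := Metric.isOpen_ball (x := y₀) (ε := ε)
  obtain ⟨y₁, hy₁, hne⟩ := exists_fieldNe_mem_ball y₀ hε
  have aξ := fun m => eq_affine_of_secondDeriv hy₁ (hξ m)
    (secondDeriv_eq_zero_of_dense hU (hξ m) fun y hy hne =>
      (pointRelations_second hU hξ hη h hy hne).1 m)
  have aη := fun k => eq_affine_of_secondDeriv hy₁ (hη k)
    (secondDeriv_eq_zero_of_dense hU (hη k) fun y hy hne =>
      secondDeriv_η_eq_zero_of_fieldNe hU hξ hη h hy hne k)
  have hP := (h y₁ hy₁).pointRelations hne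
  obtain ⟨f1, f2, f3⟩ := pointRelations_first hU hξ hη h hy₁ hne
  have s2 := (pointRelations_second hU hξ hη h hy₁ hne).2.1
  simp only [clm_apply_dir (fderiv ℝ (ξ _) y₁) (_ - y₁)] at aξ
  simp only [clm_apply_dir (fderiv ℝ (η _) y₁) (_ - y₁)] at aη
  obtain ⟨X₁, hX⟩ : ∃ X₁ : Fin 3 → Fin 3 ⊕ Fin 4 → ℝ, ∀ m a, fderiv ℝ (ξ m) y₁ (dir a) = X₁ m a :=
    ⟨_, fun _ _ => rfl⟩
  obtain ⟨N₁, hN⟩ : ∃ N₁ : Fin 4 → Fin 3 ⊕ Fin 4 → ℝ, ∀ m a, fderiv ℝ (η m) y₁ (dir a) = N₁ m a :=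
    ⟨_, fun _ _ => rfl⟩
  simp only [hX, hN] at aξ aη hP f1 f2 f3 s2
  have d1 : X₁ 1 (inl 1) = X₁ 0 (inl 0) := hP.diag 1
  have d2 : X₁ 2 (inl 2) = X₁ 0 (inl 0) := hP.diag 2
  have k01 : X₁ 1 (inl 0) = -X₁ 0 (inl 1) := by linarith [hP.skew 0 1 (by decide)]
  have k02 : X₁ 2 (inl 0) = -X₁ 0 (inl 2) := by linarith [hP.skew 0 2 (by decide)]
  have k12 : X₁ 2 (inl 1) = -X₁ 1 (inl 2) := by linarith [hP.skew 1 2 (by decide)]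
  have xu : ∀ m k, X₁ m (inr k) = 0 := fun m k => congrFun (congrFun hP.ξu_eq m) k
  have n01 : N₁ 0 (inr 1) = X₁ 0 (inl 1) := hP.ηu_off 0 1 (by decide)
  have n02 : N₁ 0 (inr 2) = X₁ 0 (inl 2) := hP.ηu_off 0 2 (by decide)
  have n12 : N₁ 1 (inr 2) = X₁ 1 (inl 2) := hP.ηu_off 1 2 (by decide)
  have n10 : N₁ 1 (inr 0) = X₁ 1 (inl 0) := hP.ηu_off 1 0 (by decide)
  have n20 : N₁ 2 (inr 0) = X₁ 2 (inl 0) := hP.ηu_off 2 0 (by decide)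
  have n21 : N₁ 2 (inr 1) = X₁ 2 (inl 1) := hP.ηu_off 2 1 (by decide)
  have n11 : N₁ 1 (inr 1) = N₁ 0 (inr 0) := by
    have : N₁ 1 (inr 1) - X₁ 1 (inl 1) = N₁ 0 (inr 0) - X₁ 0 (inl 0) := hP.ηu_diag 1
    linarith
  have n22 : N₁ 2 (inr 2) = N₁ 0 (inr 0) := by
    have : N₁ 2 (inr 2) - X₁ 2 (inl 2) = N₁ 0 (inr 0) - X₁ 0 (inl 0) := hP.ηu_diag 2
    linarith
  have p0 : N₁ 3 (inr 0) = 0 := hP.pressure_u 0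
  have p1 : N₁ 3 (inr 1) = 0 := hP.pressure_u 1
  have p2 : N₁ 3 (inr 2) = 0 := hP.pressure_u 2
  have h0 : N₁ 0 (inr 3) = 0 := f1 0
  have h1 : N₁ 1 (inr 3) = 0 := f1 1
  have h2 : N₁ 2 (inr 3) = 0 := f1 2
  have g0 : η 0 y₁ = _ := f2 0
  have g1 : η 1 y₁ = _ := f2 1
  have g2 : η 2 y₁ = _ := f2 2
  simp only [Fin.sum_univ_three, d1, d2, k01, k02, k12, Fin.castSucc_zero, Fin.castSucc_one,
    Fin.reduceCastSucc] at g0 g1 g2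
  -- R, α, δ, γ, μ are first derivatives at `y₁`; the translations and β are what remains of the
  -- values there after the linear part is subtracted. The field components leave no constant, by
  -- `g0`, `g1`, `g2`.
  refine ⟨![ξ 0 y₁ - (X₁ 0 (inl 0) * y₁.1 0 + X₁ 0 (inl 1) * y₁.1 1 + X₁ 0 (inl 2) * y₁.1 2),
    ξ 1 y₁ - (X₁ 0 (inl 0) * y₁.1 1 - X₁ 0 (inl 1) * y₁.1 0 + X₁ 1 (inl 2) * y₁.1 2),
    ξ 2 y₁ - (X₁ 0 (inl 0) * y₁.1 2 - X₁ 0 (inl 2) * y₁.1 0 - X₁ 1 (inl 2) * y₁.1 1),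
    η 3 y₁ - 2 * N₁ 0 (inr 0) * y₁.2 3, X₁ 0 (inl 0), N₁ 0 (inr 0), X₁ 0 (inl 1), X₁ 0 (inl 2),
    X₁ 1 (inl 2)], fun y hy p => ⟨fun m => ?_, fun k => ?_⟩⟩
  · rw [aξ m y hy]
    simp only [xu, Fin.sum_univ_three]
    fin_cases m <;> simp [standardOperator, plasmaOperator, d1, d2, k01, k02, k12] <;> ring
  · rw [aη k y hy]
    simp only [s2, Fin.sum_univ_four]
    fin_cases k <;> simp [standardOperator, plasmaOperator, n01, n02, n12, n10, n20, n21, n11, n22,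
      p0, p1, p2, h0, h1, h2, f3, k01, k02, k12, g0, g1, g2] <;> ring

theorem standardOperator_injective {c c' : Fin 9 → ℝ} {y₀ : (Fin 3 → ℝ) × (Fin 4 → ℝ)} {ε : ℝ}
    (hε : 0 < ε) {p : (Fin 3 → ℝ) × (Fin 4 → ℝ) → Fin 4 → Fin 3 → ℝ}
    (hξ : ∀ y ∈ Metric.ball y₀ ε,
      (standardOperator c).ξ (y.1, y.2, p y) = (standardOperator c').ξ (y.1, y.2, p y))
    (hη : ∀ y ∈ Metric.ball y₀ ε,
      (standardOperator c).η (y.1, y.2, p y) = (standardOperator c').η (y.1, y.2, p y)) : c = c' := by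
  have hmem : ∀ a : Fin 3 ⊕ Fin 4, y₀ + (ε / 2) • dir a ∈ Metric.ball y₀ ε := by
    intro a
    have hn : ‖dir a‖ ≤ 1 := by
      rcases a with a | a <;> simp [dir, Prod.norm_def, Pi.norm_single]
    rw [mem_ball_iff_norm, add_sub_cancel_left, norm_smul, Real.norm_of_nonneg (by positivity)]
    nlinarith
  have h0 := Metric.mem_ball_self (x := y₀) hε
  have a0 := hξ _ h0
  have a1 := hξ _ (hmem (inl 0))
  have a2 := hξ _ (hmem (inl 1))
  have a3 := hξ _ (hmem (inl 2))
  have b0 := hη _ h0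
  have b1 := hη _ (hmem (inr 3))
  simp [standardOperator, plasmaOperator, dir] at a0 a1 a2 a3 b0 b1
  obtain ⟨a00, a01, a02⟩ := a0
  obtain ⟨a10, a11, a12⟩ := a1
  obtain ⟨a20, a21, a22⟩ := a2
  obtain ⟨a30, a31, a32⟩ := a3
  have hε' : ε ≠ 0 := hε.ne'
  have e4 : c 4 = c' 4 := mul_right_cancel₀ hε' (by linarith)
  have e6 : c 6 = c' 6 := mul_right_cancel₀ hε' (by linarith)
  have e7 : c 7 = c' 7 := mul_right_cancel₀ hε' (by linarith)
  have e8 : c 8 = c' 8 := mul_right_cancel₀ hε' (by linarith)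
  have e5 : c 5 = c' 5 := mul_right_cancel₀ hε' (by linarith [b1.2.2.2, b0.2.2.2])
  rw [e4, e6, e7] at a00
  rw [e4, e6, e8] at a01
  rw [e4, e7, e8] at a02
  have e3 := b0.2.2.2
  rw [e5] at e3
  funext i
  fin_cases i <;> simp only [Fin.zero_eta, Fin.mk_one, Fin.reduceFinMk] <;> linarith

end PlasmaEquilibrium

/-! ### Gluing over the connected set of equations, and orbits -/

namespace PlasmaEquilibrium

open Sum Filter Topology

/-- On the system and near `J`, the operator `X` is the standard one with constants `c`. -/
def Generator.IsStandardNear (X : Generator) (S : Set Jet1) (c : Fin 9 → ℝ) (J : Jet1) : Prop :=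
  ∀ᶠ J' in 𝓝 J, J' ∈ S →
    X.ξ J' = (standardOperator c).ξ J' ∧ X.η J' = (standardOperator c).η J'

theorem Generator.IsAdmittedOn.exists_isStandardNear {X : Generator} {D : Set Jet1}
    (hX : X.IsAdmittedOn D) (hD : IsOpen D) (hS : X.SmoothOn D) {J : Jet1}
    (hJ : J ∈ D ∩ equationSet) : ∃ c, X.IsStandardNear (D ∩ equationSet) c J := by
  have hw₀ : lift (freeCoord J) ∈ D := by rw [lift_freeCoord hJ.2]; exact hJ.1
  obtain ⟨ε, hε, ξ, η, hξ, hη, eξ, eη, hp⟩ := hX.exists_point hD hS hw₀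
  obtain ⟨c, hc⟩ := exists_standard_of_isPointSymmetryAt hε hξ hη hp
  refine ⟨c, ?_⟩
  filter_upwards [continuous_freeCoord.continuousAt.eventually (Metric.ball_mem_nhds _ hε)]
    with J' hJ' hmem
  have hJ1 : (freeCoord J').1 ∈ Metric.ball (freeCoord J).1 ε :=
    lt_of_le_of_lt (le_max_left _ _) hJ'
  have h1 := eξ _ hJ'
  have h2 := eη _ hJ'
  rw [lift_freeCoord hmem.2] at h1 h2
  obtain ⟨c1, c2⟩ := hc _ hJ1 J'.2.2
  exact ⟨funext fun m => (h1 m).trans (c1 m), funext fun k => (h2 k).trans (c2 k)⟩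

/-- Fixing the free derivatives gives a section of the equations through `J` over a full ball in (x,
u), where `standardOperator_injective` applies. -/
theorem Generator.IsStandardNear.unique {X : Generator} {D : Set Jet1} (hD : IsOpen D) {J : Jet1}
    (hJ : J ∈ D ∩ equationSet) {c c' : Fin 9 → ℝ}
    (h : X.IsStandardNear (D ∩ equationSet) c J) (h' : X.IsStandardNear (D ∩ equationSet) c' J) :
    c = c' := by
  have hcont : Continuous fun y => lift (y, (freeCoord J).2) :=
    contDiff_lift.continuous.comp (by fun_prop)
  have ht : Tendsto (fun y => lift (y, (freeCoord J).2)) (𝓝 (freeCoord J).1) (𝓝 J) := by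
    have := hcont.tendsto (freeCoord J).1
    rwa [show lift ((freeCoord J).1, (freeCoord J).2) = J from lift_freeCoord hJ.2] at this
  obtain ⟨ε, hε, hb⟩ := Metric.eventually_nhds_iff_ball.1
    (ht.eventually ((h.and h').and (hD.mem_nhds hJ.1)))
  refine standardOperator_injective (y₀ := (freeCoord J).1) hε (p := fun y => slope y.2 (freeCoord J).2)
    (fun y hy => ?_) fun y hy => ?_
  · obtain ⟨⟨h1, h2⟩, h3⟩ := hb y hy
    exact (h1 ⟨h3, lift_mem _⟩).1.symm.trans (h2 ⟨h3, lift_mem _⟩).1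
  · obtain ⟨⟨h1, h2⟩, h3⟩ := hb y hy
    exact (h1 ⟨h3, lift_mem _⟩).2.symm.trans (h2 ⟨h3, lift_mem _⟩).2

theorem Generator.IsAdmittedOn.exists_standard {X : Generator} {D : Set Jet1}
    (hX : X.IsAdmittedOn D) (hD : IsOpen D) (hconn : IsPreconnected (D ∩ equationSet))
    (hS : X.SmoothOn D) : ∃ c, ∀ J ∈ D ∩ equationSet,
      X.ξ J = (standardOperator c).ξ J ∧ X.η J = (standardOperator c).η J := by
  choose c hc using fun J : ↥(D ∩ equationSet) => hX.exists_isStandardNear hD hS J.2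
  -- The constants chosen at `J` also serve at nearby points of the equations, where they must agree
  -- with those chosen there.
  have hloc : IsLocallyConstant c := by
    rw [IsLocallyConstant.iff_eventually_eq]
    intro J
    filter_upwards [continuous_subtype_val.continuousAt.eventually (hc J).eventually_nhds]
      with J' hJ'
    exact (hc J').unique hD J'.2 hJ'
  have : PreconnectedSpace ↥(D ∩ equationSet) := Subtype.preconnectedSpace hconn
  rcases (D ∩ equationSet).eq_empty_or_nonempty with he | ⟨J₀, hJ₀⟩
  · exact ⟨0, fun J hJ => by rw [he] at hJ; exact hJ.elim⟩
  · refine ⟨c ⟨J₀, hJ₀⟩, fun J hJ => ?_⟩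
    rw [hloc.apply_eq_of_preconnectedSpace ⟨J₀, hJ₀⟩ ⟨J, hJ⟩]
    exact (hc ⟨J, hJ⟩).self_of_nhds hJ

/-- The linear part of the standard operator, acting on the variables `𝐱` and `𝐮`. -/
def standardLinear (c : Fin 9 → ℝ) :
    (Fin 3 → ℝ) × (Fin 4 → ℝ) →ₗ[ℝ] (Fin 3 → ℝ) × (Fin 4 → ℝ) where
  toFun z := ((plasmaOperator 0 0 0 0 (c 4) (c 5) (c 6) (c 7) (c 8)).ξ (z.1, z.2, 0),
    (plasmaOperator 0 0 0 0 (c 4) (c 5) (c 6) (c 7) (c 8)).η (z.1, z.2, 0))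
  map_add' x y := by
    refine Prod.ext (funext fun i => ?_) (funext fun i => ?_) <;> fin_cases i <;>
      simp [plasmaOperator] <;> ring
  map_smul' t x := by
    refine Prod.ext (funext fun i => ?_) (funext fun i => ?_) <;> fin_cases i <;>
      simp [plasmaOperator] <;> ring

theorem standardOperator_eq (c : Fin 9 → ℝ) (J : Jet1) :
    ((standardOperator c).ξ J, (standardOperator c).η J) =
      ((![c 0, c 1, c 2], ![0, 0, 0, c 3]) : (Fin 3 → ℝ) × (Fin 4 → ℝ))
        + standardLinear c (J.1, J.2.1) := by
  refine Prod.ext (funext fun i => ?_) (funext fun i => ?_) <;> fin_cases i <;>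
    simp [plasmaOperator, standardLinear, standardOperator] <;> ring

/-- Both projections to (x, u) solve the same affine, hence globally Lipschitz, autonomous ODE with
the same initial value. -/
theorem Generator.IsOrbit.eq_of_standard {X : Generator} {D : Set Jet1} {c₀ : Fin 9 → ℝ}
    (hX : ∀ J ∈ D ∩ equationSet,
      X.ξ J = (standardOperator c₀).ξ J ∧ X.η J = (standardOperator c₀).η J)
    {r : ℝ} {c c' : ℝ → Jet1} (hc : X.IsOrbit D r c) (hc' : X.IsOrbit D r c')
    (h1 : (c 0).1 = (c' 0).1) (h2 : (c 0).2.1 = (c' 0).2.1) {a : ℝ} (ha : |a| < r) :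
    (c a).1 = (c' a).1 ∧ (c a).2.1 = (c' a).2.1 := by
  set L := LinearMap.toContinuousLinearMap (standardLinear c₀) with hL
  set v : (Fin 3 → ℝ) × (Fin 4 → ℝ) → (Fin 3 → ℝ) × (Fin 4 → ℝ) := fun z =>
    (![c₀ 0, c₀ 1, c₀ 2], ![0, 0, 0, c₀ 3]) + L z with hv
  have hlip : LipschitzWith ‖L‖₊ v := by
    refine LipschitzWith.of_dist_le_mul fun x y => ?_
    rw [hv, dist_add_left]
    exact L.lipschitz.dist_le_mul x y
  have horb : ∀ d : ℝ → Jet1, X.IsOrbit D r d → ∀ t ∈ Set.Ioo (-r) r,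
      HasDerivAt (fun s => ((d s).1, (d s).2.1)) (v ((d t).1, (d t).2.1)) t ∧
        ((d t).1, (d t).2.1) ∈ (Set.univ : Set ((Fin 3 → ℝ) × (Fin 4 → ℝ))) := by
    intro d hd t ht
    obtain ⟨hm, hξ, hη⟩ := hd t (abs_lt.2 ht)
    refine ⟨?_, Set.mem_univ _⟩
    obtain ⟨e1, e2⟩ := hX _ hm
    have := hξ.prodMk hη
    rw [e1, e2, standardOperator_eq] at this
    exact this
  have hr : 0 < r := (abs_nonneg a).trans_lt ha
  have := ODE_solution_unique_of_mem_Ioo (v := fun _ => v) (s := fun _ => Set.univ)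
    (fun t _ => hlip.lipschitzOnWith) (t₀ := 0) ⟨by linarith, hr⟩ (horb c hc) (horb c' hc')
    (Prod.ext h1 h2) (abs_lt.1 ha)
  exact Prod.ext_iff.1 this

end PlasmaEquilibrium

theorem mainTheorem2 :
    (∀ l₁ l₂ l₃ β R α δ γ μ : ℝ,
      (PlasmaEquilibrium.plasmaOperator l₁ l₂ l₃ β R α δ γ μ).IsAdmittedOn Set.univ) ∧
    ∀ (D : Set PlasmaEquilibrium.Jet1) (X : PlasmaEquilibrium.Generator),
      IsOpen D → IsPreconnected (D ∩ PlasmaEquilibrium.equationSet) →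
      X.SmoothOn D → X.IsAdmittedOn D →
        (∃ l₁ l₂ l₃ β R α δ γ μ : ℝ, ∀ J ∈ D ∩ PlasmaEquilibrium.equationSet,
          X.ξ J = (PlasmaEquilibrium.plasmaOperator l₁ l₂ l₃ β R α δ γ μ).ξ J ∧
          X.η J = (PlasmaEquilibrium.plasmaOperator l₁ l₂ l₃ β R α δ γ μ).η J) ∧
        (∀ (r : ℝ) (c c' : ℝ → PlasmaEquilibrium.Jet1),
          X.IsOrbit D r c → X.IsOrbit D r c' →
          (c 0).1 = (c' 0).1 → (c 0).2.1 = (c' 0).2.1 →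
          ∀ a : ℝ, |a| < r → (c a).1 = (c' a).1 ∧ (c a).2.1 = (c' a).2.1) := by
  refine ⟨PlasmaEquilibrium.plasmaOperator_isAdmittedOn, fun D X hD hconn hS hX => ?_⟩
  obtain ⟨c₀, hc₀⟩ := hX.exists_standard hD hconn hS
  exact ⟨⟨_, _, _, _, _, _, _, _, _, hc₀⟩, fun r c c' hc hc' h1 h2 a ha =>
    hc.eq_of_standard hc₀ hc' h1 h2 ha⟩
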